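/- Let $N\ge 2$, $\omega=e^{2\pi i/N}$, and let $\mathfrak W=\{[a,b,c,d]\in\mathbb P^3(\mathbb C)\mid a^{2N}+c^{2N}=b^{2N}+d^{2N}\}$ be the Fermat surface. For a point $[k':k:k_0]$ of the conic $\Lambda=\{k^2+k'^2=k_0^2\}\subset\mathbb P^2(\mathbb C)$ (affine parameters $k'/k_0$, $k/k_0$, again written $k',k$; $k'=\infty$ means $k_0=0$) let $\mathfrak W_{k',k}\subset\mathfrak W$ be the curve $$k a^N+k'c^N=k_0d^N,\quad k b^N+k'd^N=k_0c^N,\quad k_0a^N+k'b^N=k d^N,\quad k'a^N+k_0b^N=k c^N .$$ The degenerate fibres are those over $k'=0,\pm1,\infty$; $\mathrm{Sing}(\mathfrak W_{k',k})$ denotes the set of singular points of such a curve. Let $H=\langle \mathsf V_0,\mathsf V_1\rangle$ be the group of automorphisms of $\mathfrak W$ generated by $\mathsf V_0:[a,b,c,d]\mapsto[\omega a,b,\omega c,d]$ and $\mathsf V_1:[a,b,c,d]\mapsto[\omega a,b,c,\omega d]$, and let $\mathfrak W/H$ be the quotient complex space (its holomorphic functions are the $H$-invariant holomorphic functions on $\mathfrak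 W$). Then $\mathfrak W/H$ carries the structure of a two-dimensional complex orbifold, compatible with its structure of a complex space, such that: (1) the set of points with nontrivial isotropy group, and likewise the set of singular points of the complex space $\mathfrak W/H$, is the set of images of the points of $\mathrm{Sing}(\mathfrak W_{k',k})$, $k'\in\{0,\infty,1,-1\}$; (2) if $\bar p\in\mathfrak W/H$ is the image of a point of $\mathrm{Sing}(\mathfrak W_{k',k})$ with $k'=0$ or $k'=\infty$, then near $\bar p$ the orbifold is $\mathbb C^2/\langle\mathrm{diag}(\omega,\omega)\rangle$ near the origin; in particular $(\mathfrak W/H,\bar p)\simeq(\mathbb C^2/\langle\mathrm{diag}(\omega,\omega)\rangle,0)$ as germs of complex spaces; (3) if $\bar p\in\mathfrak W/H$ is the image of a point of $\mathrm{Sing}(\mathfrak W_{k',k})$ with $k'=\pm1$, then near $\bar p$ the orbifold is $\mathbb C^2/\langle\mathrm{diag}(\omega,\omega^{-1})\rangle$ near the origin, i.e. a singularity of type $A_{N-1}$; in particular $(\mathfrak W/H,\bar p)\simeq(\mathbb C^2/\langle\mathrm{diag}(\omega,\omega^{-1})\rangle,0)$ as germs of complex spaces. -/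

import Mathlib

open scoped Topology LinearAlgebra.Projectivization

noncomputable section

namespace RapidityFamily

/-! ### Spaces with holomorphic functions, and isomorphism of germs -/

/-- A notion of "the complex valued function `f` is holomorphic near `x`" on a space `X`, i.e. a
(reduced) complex structure given by its sheaf of holomorphic functions. It is used only for the
concrete spaces below: `ℂⁿ`, projective sets, and orbit spaces. -/
class HolSpace (X : Type*) where
  holAt : (X → ℂ) → X → Prop

/-- `ℂⁿ` with its usual holomorphic functions. -/
instance affineHolSpace (n : ℕ) : HolSpace (Fin n → ℂ) where
  holAt f x := AnalyticAt ℂ f x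

/-- The complex topology of projective space: the quotient topology of `ℂⁿ ∖ {0}`. -/
instance projTopology (n : ℕ) : TopologicalSpace (ℙ ℂ (Fin n → ℂ)) :=
  inferInstanceAs (TopologicalSpace (Quotient (projectivizationSetoid ℂ (Fin n → ℂ))))

/-- A function on a subset `Z` of projective space is holomorphic at `p` if, in homogeneous
coordinates, it is near (every representative of) `p` the restriction to the cone over `Z` of a
holomorphic function of the ambient space. -/
instance projHolSpace {n : ℕ} (Z : Set (ℙ ℂ (Fin n → ℂ))) : HolSpace Z where
  holAt f p := ∀ (v : Fin n → ℂ) (hv : v ≠ 0), Projectivization.mk ℂ v hv = p.1 →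
    ∃ g : (Fin n → ℂ) → ℂ, AnalyticAt ℂ g v ∧
      ∀ᶠ w in 𝓝 v, ∀ (hw : w ≠ 0) (hZ : Projectivization.mk ℂ w hw ∈ Z),
        f ⟨Projectivization.mk ℂ w hw, hZ⟩ = g w

/-- The orbit space of a group action: its topology is the quotient topology (Mathlib's
instance), its holomorphic functions are the invariant holomorphic functions upstairs. -/
instance quotientHolSpace (G X : Type*) [Group G] [MulAction G X] [HolSpace X] :
    HolSpace (MulAction.orbitRel.Quotient G X) where
  holAt f q := ∀ x : X, (Quotient.mk _ x : MulAction.orbitRel.Quotient G X) = q →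
    HolSpace.holAt (fun y : X => f (Quotient.mk _ y)) x

/-- The germs `(X, x)` and `(Y, y)` are isomorphic: there is a homeomorphism of an open
neighbourhood of `x` onto one of `y` that takes `x` to `y` and identifies the holomorphic functions
on both sides. -/
def GermIso {X Y : Type*} [TopologicalSpace X] [TopologicalSpace Y] [HolSpace X] [HolSpace Y]
    (x : X) (y : Y) : Prop :=
  ∃ e : OpenPartialHomeomorph X Y, x ∈ e.source ∧ e x = y ∧
    ∀ x' ∈ e.source, ∀ f : Y → ℂ,
      HolSpace.holAt f (e x') ↔ HolSpace.holAt (fun z : X => f (e z)) x'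

/-- `x` is a nonsingular point of the `n`-dimensional complex space `X`. -/
def IsNonsingularAt {X : Type*} [TopologicalSpace X] [HolSpace X] (n : ℕ) (x : X) : Prop :=
  GermIso x (0 : Fin n → ℂ)

/-! ### Complex orbifolds -/

/-- The general linear group of `ℂⁿ`; it acts on `ℂⁿ` and on the projective space of `ℂⁿ`. -/
abbrev GLin (n : ℕ) : Type := (Fin n → ℂ) ≃ₗ[ℂ] (Fin n → ℂ)

/-- The diagonal matrix with diagonal entries `t`. -/
def diag {n : ℕ} (t : Fin n → ℂˣ) : GLin n :=
  LinearEquiv.piCongrRight fun i => LinearEquiv.smulOfUnit (t i)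

/-- An orbifold chart of `X`: a connected open set of `ℂⁿ`, a finite group acting on it (taken
linear, hence effective), and a map that induces an isomorphism of complex spaces from the orbit
space of the domain onto an open set of `X`. The values of `toFun` off the domain are irrelevant. -/
structure OrbifoldChart (n : ℕ) (X : Type*) [TopologicalSpace X] [HolSpace X] where
  dom : Set (Fin n → ℂ)
  isOpen_dom : IsOpen dom
  isConnected_dom : IsConnected dom
  group : Subgroup (GLin n)
  finite_group : Finite group
  map_dom : ∀ g ∈ group, ∀ x ∈ dom, g x ∈ dom
  toFun : (Fin n → ℂ) → X
  continuousOn_toFun : ContinuousOn toFun dom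
  isOpen_image : ∀ V ⊆ dom, IsOpen V → IsOpen (toFun '' V)
  toFun_eq_iff : ∀ x ∈ dom, ∀ y ∈ dom, toFun x = toFun y ↔ ∃ g ∈ group, g x = y
  holAt_iff : ∀ x ∈ dom, ∀ f : X → ℂ,
    HolSpace.holAt f (toFun x) ↔ HolSpace.holAt (fun z => f (toFun z)) x

/-- A complex orbifold structure on `X`: orbifold charts that cover `X`, any two of which are
related, near points with the same image, by a local biholomorphic map over `X`. -/
structure OrbifoldAtlas (n : ℕ) (X : Type*) [TopologicalSpace X] [HolSpace X] where
  t2Space : T2Space X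
  secondCountable : SecondCountableTopology X
  charts : Set (OrbifoldChart n X)
  cover : ∀ q : X, ∃ c ∈ charts, q ∈ c.toFun '' c.dom
  compatible : ∀ c ∈ charts, ∀ c' ∈ charts, ∀ x ∈ c.dom, ∀ y ∈ c'.dom, c.toFun x = c'.toFun y →
    ∃ h : OpenPartialHomeomorph (Fin n → ℂ) (Fin n → ℂ),
      x ∈ h.source ∧ h x = y ∧ h.source ⊆ c.dom ∧ h.target ⊆ c'.dom ∧
      AnalyticOnNhd ℂ h h.source ∧ AnalyticOnNhd ℂ h.symm h.target ∧
      ∀ z ∈ h.source, c'.toFun (h z) = c.toFun z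

/-- The singular locus of an orbifold: the points with nontrivial isotropy group. -/
def OrbifoldAtlas.singularLocus {n : ℕ} {X : Type*} [TopologicalSpace X] [HolSpace X]
    (A : OrbifoldAtlas n X) : Set X :=
  {q | ∃ c ∈ A.charts, ∃ x ∈ c.dom, c.toFun x = q ∧ ∃ g ∈ c.group, g ≠ 1 ∧ g x = x}

/-- Near `q` the orbifold is `ℂⁿ / G` near the origin: it has a chart with group `G` centred
at `q`. -/
def OrbifoldAtlas.LocallyQuotient {n : ℕ} {X : Type*} [TopologicalSpace X] [HolSpace X]
    (A : OrbifoldAtlas n X) (q : X) (G : Subgroup (GLin n)) : Prop :=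
  ∃ c ∈ A.charts, c.group = G ∧ (0 : Fin n → ℂ) ∈ c.dom ∧ c.toFun 0 = q

/-! ### Projective sets and their singular points -/

/-- The common zeros in projective space of a family of homogeneous polynomials. -/
def projZeros {m n : ℕ} (F : Fin m → MvPolynomial (Fin n) ℂ) : Set (ℙ ℂ (Fin n → ℂ)) :=
  {p | ∀ i, MvPolynomial.eval p.rep (F i) = 0}

/-- The Jacobian matrix of a family of polynomials at a vector. -/
def jacobian {m n : ℕ} (F : Fin m → MvPolynomial (Fin n) ℂ) (v : Fin n → ℂ) :
    Matrix (Fin m) (Fin n) ℂ :=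
  Matrix.of fun i j => MvPolynomial.eval v (MvPolynomial.pderiv j (F i))

/-- The singular points (Jacobian criterion) of a projective variety of codimension `c` given by
the homogeneous equations `F`. -/
def projSing {m n : ℕ} (c : ℕ) (F : Fin m → MvPolynomial (Fin n) ℂ) : Set (ℙ ℂ (Fin n → ℂ)) :=
  {p | p ∈ projZeros F ∧ (jacobian F p.rep).rank < c}

/-! ### The rapidity family

The homogeneous coordinates `a, b, c, d` have the indices `0, 1, 2, 3`. -/

open MvPolynomial in
/-- The equation `a^{2N} + c^{2N} = b^{2N} + d^{2N}`. -/
def fermatEq (N : ℕ) : Fin 1 → MvPolynomial (Fin 4) ℂ :=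
  ![X 0 ^ (2 * N) + X 2 ^ (2 * N) - (X 1 ^ (2 * N) + X 3 ^ (2 * N))]

/-- The rapidity family, as the Fermat surface in projective 3-space. -/
abbrev Fermat (N : ℕ) : Type := projZeros (fermatEq N)

/-- Homogeneous coordinates `[k' : k : k₀]` of a point of the conic `k² + k'² = k₀²`. The affine
parameters are `k'/k₀` and `k/k₀`; the points at infinity are those with `k₀ = 0`. -/
structure Param where
  k' : ℂ
  k : ℂ
  k₀ : ℂ
  ne_zero : (k', k, k₀) ≠ 0
  conic : k ^ 2 + k' ^ 2 = k₀ ^ 2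

/-- `k' = 0` or `k' = ∞`. -/
def Param.ZeroOrInfty (κ : Param) : Prop := κ.k' = 0 ∨ κ.k₀ = 0

/-- `k' = 1` or `k' = -1`. -/
def Param.PlusMinusOne (κ : Param) : Prop := κ.k' = κ.k₀ ∨ κ.k' = -κ.k₀

open MvPolynomial in
/-- The four equations of the rapidity curve over a parameter, homogenized in the parameter:
`k a^N + k' c^N = k₀ d^N`, `k b^N + k' d^N = k₀ c^N`,
`k₀ a^N + k' b^N = k d^N`, `k' a^N + k₀ b^N = k c^N`. -/
def rapidityEqs (N : ℕ) (κ : Param) : Fin 4 → MvPolynomial (Fin 4) ℂ :=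
  ![C κ.k * X 0 ^ N + C κ.k' * X 2 ^ N - C κ.k₀ * X 3 ^ N,
    C κ.k * X 1 ^ N + C κ.k' * X 3 ^ N - C κ.k₀ * X 2 ^ N,
    C κ.k₀ * X 0 ^ N + C κ.k' * X 1 ^ N - C κ.k * X 3 ^ N,
    C κ.k' * X 0 ^ N + C κ.k₀ * X 1 ^ N - C κ.k * X 2 ^ N]

/-- The singular points of the fibre over `κ`, a curve in projective 3-space. -/
def fibreSing (N : ℕ) (κ : Param) : Set (Fermat N) :=
  {p | p.1 ∈ projSing 2 (rapidityEqs N κ)}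

/-- `ω = exp (2πi/N)`. -/
def omega (N : ℕ) : ℂˣ := Units.mk0 (Complex.exp (2 * Real.pi * Complex.I / N)) (Complex.exp_ne_zero _)

lemma omega_pow (N : ℕ) : (omega N : ℂ) ^ (2 * N) = 1 := by
  rcases eq_or_ne N 0 with rfl | h
  · simp
  · have := (Complex.isPrimitiveRoot_exp N h).pow_eq_one
    rw [mul_comm, pow_mul]
    simp [omega, this]

lemma diag_smul_mem (N : ℕ) (t : Fin 4 → ℂˣ) (ht : ∀ i, (t i : ℂ) ^ (2 * N) = 1)
    (p : ℙ ℂ (Fin 4 → ℂ)) : diag t • p ∈ projZeros (fermatEq N) ↔ p ∈ projZeros (fermatEq N) := by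
  obtain ⟨s, hs⟩ := Projectivization.exists_smul_eq_mk_rep ℂ (diag t • p.rep)
    ((smul_ne_zero_iff_ne _).2 p.rep_nonzero)
  have hq : diag t • p = Projectivization.mk ℂ (diag t • p.rep)
      ((smul_ne_zero_iff_ne _).2 p.rep_nonzero) := by
    conv_lhs => rw [← p.mk_rep]
    rfl
  have hr : ∀ i, (diag t • p).rep i = s * (t i * p.rep i) := by
    intro i
    rw [hq, ← hs]
    rfl
  have hs0 : (s : ℂ) ^ (2 * N) ≠ 0 := pow_ne_zero _ s.ne_zero
  simp only [projZeros, fermatEq, Set.mem_ofPred_eq, Fin.forall_fin_one, Matrix.cons_val_fin_one,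
    map_sub, map_add, map_pow, MvPolynomial.eval_X, hr, mul_pow, ht, one_mul]
  rw [← mul_add, ← mul_add, ← mul_sub, mul_eq_zero]
  simp [hs0]

/-- The automorphism of the Fermat surface that multiplies the four coordinates by `t`. -/
def diagAut (N : ℕ) (t : Fin 4 → ℂˣ) (ht : ∀ i, (t i : ℂ) ^ (2 * N) = 1) :
    Equiv.Perm (Fermat N) :=
  (MulAction.toPerm (diag t) : Equiv.Perm (ℙ ℂ (Fin 4 → ℂ))).subtypePerm (diag_smul_mem N t ht)

/-- `V₀ : [a, b, c, d] ↦ [ω a, b, ω c, d]`. -/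
def V₀ (N : ℕ) : Equiv.Perm (Fermat N) :=
  diagAut N ![omega N, 1, omega N, 1] (by intro i; fin_cases i <;> simp [omega_pow])

/-- `V₁ : [a, b, c, d] ↦ [ω a, b, c, ω d]`. -/
def V₁ (N : ℕ) : Equiv.Perm (Fermat N) :=
  diagAut N ![omega N, 1, 1, omega N] (by intro i; fin_cases i <;> simp [omega_pow])

/-- The group `H` of automorphisms of the Fermat surface generated by `V₀` and `V₁`. -/
def H (N : ℕ) : Subgroup (Equiv.Perm (Fermat N)) := Subgroup.closure {V₀ N, V₁ N}

/-- The quotient surface. -/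
abbrev WH (N : ℕ) : Type := MulAction.orbitRel.Quotient (H N) (Fermat N)

/-- The image in the quotient surface of a point of the Fermat surface. -/
def toWH (N : ℕ) (p : Fermat N) : WH N := Quotient.mk _ p

/-- The images of the singular points of the degenerate fibres, those over `k' = 0, ∞, ±1`. -/
def singImage (N : ℕ) : Set (WH N) :=
  {q | ∃ κ : Param, (κ.ZeroOrInfty ∨ κ.PlusMinusOne) ∧ ∃ p ∈ fibreSing N κ, toWH N p = q}

/-- The orbit space `ℂ² / G`. -/
abbrev PlaneQuotient (G : Subgroup (GLin 2)) : Type := MulAction.orbitRel.Quotient G (Fin 2 → ℂ)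

/-- The image of the origin in `ℂ² / G`. -/
def planeOrigin (G : Subgroup (GLin 2)) : PlaneQuotient G := Quotient.mk _ 0

/-- The group generated by `diag(ω, ω)`. -/
def scalarGroup (N : ℕ) : Subgroup (GLin 2) := Subgroup.zpowers (diag ![omega N, omega N])

/-- The group generated by `diag(ω, ω⁻¹)`, which defines the singularity of type `A_{N-1}`. -/
def typeAGroup (N : ℕ) : Subgroup (GLin 2) := Subgroup.zpowers (diag ![omega N, (omega N)⁻¹])

end RapidityFamily

end

open scoped Topology LinearAlgebra.Projectivization

noncomputable section

namespace RapidityFamily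

/-! ### Germs and orbifold charts from local parametrizations -/

theorem GermIso.trans {X Y Z : Type*} [TopologicalSpace X] [TopologicalSpace Y]
    [TopologicalSpace Z] [HolSpace X] [HolSpace Y] [HolSpace Z] {x : X} {y : Y} {z : Z}
    (h₁ : GermIso x y) (h₂ : GermIso y z) : GermIso x z := by
  obtain ⟨e, hx, rfl, he⟩ := h₁
  obtain ⟨e', hy, rfl, he'⟩ := h₂
  refine ⟨e.trans e', ?_, rfl, ?_⟩
  · simp [hx, hy]
  · intro x' hx' f
    simp only [OpenPartialHomeomorph.trans_source, Set.mem_inter_iff, Set.mem_preimage] at hx'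
    exact (he' _ hx'.2 f).trans (he _ hx'.1 fun y => f (e' y))

/-- The preimage chosen by `invFunOn` lies in the same fibre of `α` as `x`, hence in the same fibre
of `β`. So `β ∘ invFunOn α D` is the map induced between the images, whatever choices are made. -/
theorem comp_invFunOn_eq {E X Y : Type*} [Nonempty E] {D : Set E} {α : E → X} {β : E → Y}
    (fib : ∀ x ∈ D, ∀ y ∈ D, α x = α y ↔ β x = β y) :
    ∀ x ∈ D, β (Function.invFunOn α D (α x)) = β x := by
  intro x hx
  have hex : ∃ y ∈ D, α y = α x := ⟨x, hx, rfl⟩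
  exact (fib _ (Function.invFunOn_mem hex) _ hx).1 (Function.invFunOn_eq hex)

theorem continuousOn_comp_invFunOn {E X Y : Type*} [Nonempty E] [TopologicalSpace E]
    [TopologicalSpace X] [TopologicalSpace Y] {D : Set E} (hD : IsOpen D) {α : E → X} {β : E → Y}
    (hβ : ContinuousOn β D) (oα : ∀ V ⊆ D, IsOpen V → IsOpen (α '' V))
    (k : ∀ x ∈ D, β (Function.invFunOn α D (α x)) = β x) :
    ContinuousOn (fun q => β (Function.invFunOn α D q)) (α '' D) := by
  rw [continuousOn_open_iff (oα D subset_rfl hD)]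
  intro V hV
  have : α '' D ∩ (fun q => β (Function.invFunOn α D q)) ⁻¹' V = α '' (D ∩ β ⁻¹' V) := by
    ext q
    constructor
    · rintro ⟨⟨x, hx, rfl⟩, hq⟩
      exact ⟨x, ⟨hx, by simpa [k x hx] using hq⟩, rfl⟩
    · rintro ⟨x, ⟨hx, hq⟩, rfl⟩
      exact ⟨⟨x, hx, rfl⟩, by simpa [k x hx] using hq⟩
  rw [this]
  exact oα _ Set.inter_subset_left (hβ.isOpen_inter_preimage hD hV)

/-- Two maps on an open set of `ℂⁿ` that present open sets of `X` and of `Y` as the same quotient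
identify these open sets. -/
theorem germIso_of_common_cover {n : ℕ} {X Y : Type*} [TopologicalSpace X] [TopologicalSpace Y]
    [HolSpace X] [HolSpace Y] {D : Set (Fin n → ℂ)} (hD : IsOpen D) {α : (Fin n → ℂ) → X}
    {β : (Fin n → ℂ) → Y} (hα : ContinuousOn α D) (hβ : ContinuousOn β D)
    (oα : ∀ V ⊆ D, IsOpen V → IsOpen (α '' V)) (oβ : ∀ V ⊆ D, IsOpen V → IsOpen (β '' V))
    (fib : ∀ x ∈ D, ∀ y ∈ D, α x = α y ↔ β x = β y)
    (holα : ∀ x ∈ D, ∀ f : X → ℂ, HolSpace.holAt f (α x) ↔ AnalyticAt ℂ (fun z => f (α z)) x)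
    (holβ : ∀ x ∈ D, ∀ f : Y → ℂ, HolSpace.holAt f (β x) ↔ AnalyticAt ℂ (fun z => f (β z)) x)
    {x : Fin n → ℂ} (hx : x ∈ D) : GermIso (α x) (β x) := by
  have k₁ := comp_invFunOn_eq fib
  have k₂ := comp_invFunOn_eq fun x hx y hy => (fib x hx y hy).symm
  refine ⟨{ toFun := fun q => β (Function.invFunOn α D q)
            invFun := fun q => α (Function.invFunOn β D q)
            source := α '' D
            target := β '' D
            map_source' := ?_
            map_target' := ?_
            left_inv' := ?_
            right_inv' := ?_
            open_source := oα D subset_rfl hD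
            open_target := oβ D subset_rfl hD
            continuousOn_toFun := continuousOn_comp_invFunOn hD hβ oα k₁
            continuousOn_invFun := continuousOn_comp_invFunOn hD hα oβ k₂ }, ⟨x, hx, rfl⟩, k₁ x hx, ?_⟩
  · rintro _ ⟨y, hy, rfl⟩
    exact ⟨y, hy, (k₁ y hy).symm⟩
  · rintro _ ⟨y, hy, rfl⟩
    exact ⟨y, hy, (k₂ y hy).symm⟩
  · rintro _ ⟨y, hy, rfl⟩
    simp only [k₁ y hy, k₂ y hy]
  · rintro _ ⟨y, hy, rfl⟩
    simp only [k₁ y hy, k₂ y hy]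
  · rintro _ ⟨y, hy, rfl⟩ f
    change HolSpace.holAt f (β (Function.invFunOn α D (α y))) ↔
      HolSpace.holAt (fun z => f (β (Function.invFunOn α D z))) (α y)
    rw [k₁ y hy, holβ y hy, holα y hy]
    refine analyticAt_congr ?_
    filter_upwards [hD.mem_nhds hy] with z hz
    rw [k₁ z hz]

/-- A holomorphic function on an orbit space of a group of automorphisms may be tested at any
point of the orbit. -/
theorem holAt_quotient_iff {G X : Type*} [Group G] [MulAction G X] [HolSpace X]
    (hG : ∀ (g : G) (x : X) (f : X → ℂ),
      HolSpace.holAt f (g • x) ↔ HolSpace.holAt (fun y => f (g • y)) x)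
    (f : MulAction.orbitRel.Quotient G X → ℂ) (x : X) :
    HolSpace.holAt f (Quotient.mk _ x : MulAction.orbitRel.Quotient G X) ↔
      HolSpace.holAt (fun y : X => f (Quotient.mk _ y)) x := by
  refine ⟨fun h => h x rfl, fun h y hy => ?_⟩
  obtain ⟨g, rfl⟩ : ∃ g : G, g • x = y := MulAction.orbitRel_apply.1 (Quotient.exact hy)
  rw [hG]
  convert h using 3
  exact Quotient.sound (MulAction.orbitRel_apply.2 ⟨g, rfl⟩)

theorem analyticAt_coord {n : ℕ} (i : Fin n) (x : Fin n → ℂ) :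
    AnalyticAt ℂ (fun z : Fin n → ℂ => z i) x :=
  (ContinuousLinearMap.proj (R := ℂ) (φ := fun _ : Fin n => ℂ) i).analyticAt x

theorem analyticAt_linear {n : ℕ} (g : GLin n) (x : Fin n → ℂ) :
    AnalyticAt ℂ (fun y : Fin n → ℂ => g y) x :=
  (LinearMap.toContinuousLinearMap (g : (Fin n → ℂ) →ₗ[ℂ] (Fin n → ℂ))).analyticAt x

theorem holAt_linear_smul {n : ℕ} (K : Subgroup (GLin n)) (g : K) (x : Fin n → ℂ)
    (f : (Fin n → ℂ) → ℂ) :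
    HolSpace.holAt f (g • x) ↔ HolSpace.holAt (fun y => f (g • y)) x := by
  have comp : ∀ (g : K) (x : Fin n → ℂ) (f : (Fin n → ℂ) → ℂ),
      AnalyticAt ℂ f (g • x) → AnalyticAt ℂ (fun y => f (g • y)) x :=
    fun g x f hf => AnalyticAt.comp (g := f) hf (analyticAt_linear (g : GLin n) x)
  refine ⟨comp g x f, fun h => ?_⟩
  have := comp g⁻¹ (g • x) (fun y => f (g • y)) (by rw [inv_smul_smul]; exact h)
  change AnalyticAt ℂ f (g • x)
  simpa using this

theorem holAt_planeQuotient_iff {n : ℕ} (K : Subgroup (GLin n))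
    (f : MulAction.orbitRel.Quotient K (Fin n → ℂ) → ℂ) (x : Fin n → ℂ) :
    HolSpace.holAt f (Quotient.mk _ x : MulAction.orbitRel.Quotient K (Fin n → ℂ)) ↔
      AnalyticAt ℂ (fun y : Fin n → ℂ => f (Quotient.mk _ y)) x :=
  holAt_quotient_iff (holAt_linear_smul K) f x

instance linearContinuousConstSMul {n : ℕ} (K : Subgroup (GLin n)) :
    ContinuousConstSMul K (Fin n → ℂ) where
  continuous_const_smul g := continuous_iff_continuousAt.2 fun x =>
    (analyticAt_linear (g : GLin n) x).continuousAt

/-! ### Orbifold charts as isomorphisms of germs -/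

section OrbifoldChart

variable {n : ℕ} {X : Type*} [TopologicalSpace X] [HolSpace X] (c : OrbifoldChart n X)

theorem mk_eq_mk_iff_exists_linear (K : Subgroup (GLin n)) (x y : Fin n → ℂ) :
    (Quotient.mk _ x : MulAction.orbitRel.Quotient K (Fin n → ℂ)) = Quotient.mk _ y ↔
      ∃ g ∈ K, g x = y := by
  rw [Quotient.eq, MulAction.orbitRel_apply, ← MulAction.mem_orbit_symm]
  constructor
  · rintro ⟨g, hg⟩
    exact ⟨g, g.2, hg⟩
  · rintro ⟨g, hg, h⟩
    exact ⟨⟨g, hg⟩, h⟩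

theorem isOpen_mk_image (K : Subgroup (GLin n)) {V : Set (Fin n → ℂ)} (hV : IsOpen V) :
    IsOpen ((fun x => (Quotient.mk _ x : MulAction.orbitRel.Quotient K (Fin n → ℂ))) '' V) :=
  isOpenMap_quotient_mk'_mul V hV

/-- An orbifold chart is an isomorphism of germs with the orbit space of its domain. -/
theorem OrbifoldChart.germIso {x : Fin n → ℂ} (hx : x ∈ c.dom) :
    GermIso (c.toFun x) (Quotient.mk _ x : MulAction.orbitRel.Quotient c.group (Fin n → ℂ)) :=
  germIso_of_common_cover c.isOpen_dom (α := c.toFun)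
    (β := fun x => (Quotient.mk _ x : MulAction.orbitRel.Quotient c.group (Fin n → ℂ)))
    c.continuousOn_toFun continuous_quotient_mk'.continuousOn c.isOpen_image
    (fun _ _ hV => isOpen_mk_image _ hV)
    (fun x hx y hy => (c.toFun_eq_iff x hx y hy).trans (mk_eq_mk_iff_exists_linear _ x y).symm)
    c.holAt_iff (fun x _ f => holAt_planeQuotient_iff _ f x) hx

theorem OrbifoldChart.germIso_symm {x : Fin n → ℂ} (hx : x ∈ c.dom) :
    GermIso (Quotient.mk _ x : MulAction.orbitRel.Quotient c.group (Fin n → ℂ)) (c.toFun x) :=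
  germIso_of_common_cover c.isOpen_dom
    (α := fun x => (Quotient.mk _ x : MulAction.orbitRel.Quotient c.group (Fin n → ℂ)))
    (β := c.toFun)
    continuous_quotient_mk'.continuousOn c.continuousOn_toFun (fun _ _ hV => isOpen_mk_image _ hV)
    c.isOpen_image
    (fun x hx y hy => (mk_eq_mk_iff_exists_linear _ x y).trans (c.toFun_eq_iff x hx y hy).symm)
    (fun x _ f => holAt_planeQuotient_iff _ f x) c.holAt_iff hx

theorem analyticAt_comp_sub_iff (a x : Fin n → ℂ) (f : (Fin n → ℂ) → ℂ) :
    AnalyticAt ℂ f (x - a) ↔ AnalyticAt ℂ (fun z => f (z - a)) x := by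
  constructor
  · intro h
    exact AnalyticAt.comp (g := f) (f := fun z => z - a) h (by fun_prop)
  · intro h
    have h' : AnalyticAt ℂ (fun z => f (z - a)) ((x - a) + a) := by simpa using h
    simpa [Function.comp_def] using
      AnalyticAt.comp (g := fun z => f (z - a)) (f := fun z => z + a) h' (by fun_prop)

/-- The points in the image of an orbifold chart with trivial group are nonsingular. -/
theorem OrbifoldChart.isNonsingularAt (hc : c.group = ⊥) {x : Fin n → ℂ} (hx : x ∈ c.dom) :
    IsNonsingularAt n (c.toFun x) := by
  have h := germIso_of_common_cover c.isOpen_dom (α := c.toFun) (β := fun z => z - x)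
    c.continuousOn_toFun (by fun_prop) c.isOpen_image
    (fun V _ hV => (Homeomorph.subRight x).isOpenMap V hV)
    (fun y hy z hz => by rw [c.toFun_eq_iff y hy z hz, hc]; simp)
    c.holAt_iff (fun y _ f => analyticAt_comp_sub_iff x y f) hx
  simpa [IsNonsingularAt] using h

end OrbifoldChart

/-! ### Local parametrizations upstairs and the charts they induce on the orbit space -/

section LocalParam

variable {n : ℕ} {G X : Type*} [TopologicalSpace X] [HolSpace X]

/-- A local biholomorphic parametrization of `X` by an open set of `ℂⁿ`. -/
def IsLocalParam (e : OpenPartialHomeomorph (Fin n → ℂ) X) : Prop :=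
  ∀ x ∈ e.source, ∀ f : X → ℂ, HolSpace.holAt f (e x) ↔ AnalyticAt ℂ (fun z => f (e z)) x

variable [Group G] [MulAction G X] [ContinuousConstSMul G X]

/-- The orbifold chart of an orbit space induced by a local parametrization upstairs. -/
def quotientChart
    (hG : ∀ (g : G) (x : X) (f : X → ℂ),
      HolSpace.holAt f (g • x) ↔ HolSpace.holAt (fun y => f (g • y)) x)
    (e : OpenPartialHomeomorph (Fin n → ℂ) X) (he : IsLocalParam e)
    (D : Set (Fin n → ℂ)) (hD : IsOpen D) (hDc : IsConnected D) (hDe : D ⊆ e.source)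
    (K : Subgroup (GLin n)) (hK : Finite K) (hKD : ∀ g ∈ K, ∀ x ∈ D, g x ∈ D)
    (hfib : ∀ x ∈ D, ∀ y ∈ D, (∃ g : G, g • e x = e y) ↔ ∃ k ∈ K, k x = y) :
    OrbifoldChart n (MulAction.orbitRel.Quotient G X) where
  dom := D
  isOpen_dom := hD
  isConnected_dom := hDc
  group := K
  finite_group := hK
  map_dom := hKD
  toFun x := Quotient.mk _ (e x)
  continuousOn_toFun := continuous_quotient_mk'.comp_continuousOn (e.continuousOn.mono hDe)
  isOpen_image V hV hVo := by
    have : IsOpen (e '' V) := e.isOpen_image_of_subset_source hVo (hV.trans hDe)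
    rw [← Set.image_image (fun y => (Quotient.mk _ y : MulAction.orbitRel.Quotient G X)) e V]
    exact isOpenMap_quotient_mk'_mul _ this
  toFun_eq_iff x hx y hy := by
    rw [← hfib x hx y hy, Quotient.eq, MulAction.orbitRel_apply, ← MulAction.mem_orbit_symm]
    rfl
  holAt_iff x hx f := (holAt_quotient_iff hG f (e x)).trans (he x (hDe hx) _)

theorem IsLocalParam.holAt_symm_apply {e : OpenPartialHomeomorph (Fin n → ℂ) X}
    (he : IsLocalParam e) {p : X} (hp : p ∈ e.target) (i : Fin n) :
    HolSpace.holAt (fun q => e.symm q i) p := by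
  have h := (he (e.symm p) (e.map_target hp) fun q => e.symm q i).2 (by
    refine (analyticAt_coord i _).congr ?_
    filter_upwards [e.open_source.mem_nhds (e.map_target hp)] with z hz
    rw [e.left_inv hz])
  rwa [e.right_inv hp] at h

/-- Two local parametrizations are related by a biholomorphic map over the orbit space. -/
theorem IsLocalParam.exists_transition
    (hG : ∀ (g : G) (x : X) (f : X → ℂ),
      HolSpace.holAt f (g • x) ↔ HolSpace.holAt (fun y => f (g • y)) x)
    {e e' : OpenPartialHomeomorph (Fin n → ℂ) X} (he : IsLocalParam e) (he' : IsLocalParam e')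
    {D D' : Set (Fin n → ℂ)} (hD : IsOpen D) (hD' : IsOpen D') (hDe : D ⊆ e.source)
    (hDe' : D' ⊆ e'.source) {x y : Fin n → ℂ} (hx : x ∈ D) (hy : y ∈ D') {g : G}
    (hg : g • e x = e' y) :
    ∃ h : OpenPartialHomeomorph (Fin n → ℂ) (Fin n → ℂ),
      x ∈ h.source ∧ h x = y ∧ h.source ⊆ D ∧ h.target ⊆ D' ∧
      AnalyticOnNhd ℂ h h.source ∧ AnalyticOnNhd ℂ h.symm h.target ∧
      ∀ z ∈ h.source, g • e z = e' (h z) := by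
  let τ : OpenPartialHomeomorph X X := (Homeomorph.smul g).toOpenPartialHomeomorph
  let E := e.restrOpen D hD
  let E' := e'.restrOpen D' hD'
  -- The transition is `e'⁻¹ ∘ g ∘ e`, restricted to the two domains; its inverse has the same form
  -- with `g⁻¹`, so `ana` serves for both.
  let h := (E.trans τ).trans E'.symm
  have ana : ∀ {a a' : OpenPartialHomeomorph (Fin n → ℂ) X}, IsLocalParam a → IsLocalParam a' →
      ∀ (g : G) (z : Fin n → ℂ), z ∈ a.source → g • a z ∈ a'.target →
      AnalyticAt ℂ (fun w => a'.symm (g • a w)) z := by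
    intro a a' ha ha' g z hz hz'
    rw [analyticAt_pi_iff]
    intro i
    have h₁ := ha'.holAt_symm_apply hz' i
    rw [hG] at h₁
    exact (ha z hz _).1 h₁
  have src : ∀ z, z ∈ h.source ↔ (z ∈ e.source ∧ z ∈ D) ∧ g • e z ∈ e'.target ∧
      e'.symm (g • e z) ∈ D' := by
    intro z
    simp [h, E, E', τ, and_assoc]
  have tgt : ∀ z, z ∈ h.target → (z ∈ e'.source ∧ z ∈ D') ∧ g⁻¹ • e' z ∈ e.target ∧
      e.symm (g⁻¹ • e' z) ∈ D := by
    intro z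
    simp [h, E, E', τ, and_assoc]
  have hxy : e'.symm (g • e x) = y := by rw [hg, e'.left_inv (hDe' hy)]
  refine ⟨h, ?_, hxy, fun z hz => ((src z).1 hz).1.2, fun z hz => (tgt z hz).1.2, ?_, ?_, ?_⟩
  · rw [src, hxy, hg]
    exact ⟨⟨hDe hx, hx⟩, e'.map_source (hDe' hy), hy⟩
  · intro z hz
    have := (src z).1 hz
    exact ana he he' g z this.1.1 this.2.1
  · intro z hz
    have := tgt z hz
    exact ana he' he g⁻¹ z this.1.1 this.2.1
  · intro z hz
    have := (src z).1 hz
    exact (e'.right_inv this.2.1).symm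

end LocalParam

/-! ### Finite groups acting on Hausdorff spaces -/

section FiniteGroup

variable {G X : Type*} [TopologicalSpace X] [Group G] [MulAction G X] [ContinuousConstSMul G X]

/-- For a finite group acting on a Hausdorff space, a point has a neighbourhood that meets only
its translates under the stabilizer. -/
theorem exists_isOpen_smul_eq_of_mem [Finite G] [T2Space X] (p : X) :
    ∃ U : Set X, IsOpen U ∧ p ∈ U ∧ ∀ g : G, ∀ x ∈ U, g • x ∈ U → g • p = p := by
  have h : ∀ g : G, ∃ U : Set X, IsOpen U ∧ p ∈ U ∧ ∀ x ∈ U, g • x ∈ U → g • p = p := by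
    intro g
    by_cases hg : g • p = p
    · exact ⟨Set.univ, isOpen_univ, trivial, fun _ _ _ => hg⟩
    · obtain ⟨A, B, hA, hB, hpA, hpB, hAB⟩ := t2_separation hg
      refine ⟨B ∩ (fun x => g • x) ⁻¹' A, hB.inter (hA.preimage (continuous_const_smul g)),
        ⟨hpB, hpA⟩, fun x hx hgx => ?_⟩
      exact (Set.disjoint_left.1 hAB hx.2 hgx.1).elim
  choose U hU hp hUg using h
  exact ⟨⋂ g, U g, isOpen_iInter_of_finite hU, Set.mem_iInter.2 hp, fun g x hx hgx =>
    hUg g x (Set.mem_iInter.1 hx g) (Set.mem_iInter.1 hgx g)⟩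

/-- The orbit relation is a finite union of graphs of continuous maps, hence closed, and the
quotient map is open. -/
theorem t2Space_orbitRel_quotient [Finite G] [T2Space X] :
    T2Space (MulAction.orbitRel.Quotient G X) := by
  have hq : IsOpenQuotientMap (fun x => (Quotient.mk _ x : MulAction.orbitRel.Quotient G X)) :=
    ⟨Quotient.mk_surjective, continuous_quotient_mk', isOpenMap_quotient_mk'_mul⟩
  rw [t2Space_iff_of_isOpenQuotientMap hq]
  have : {q : X × X | (Quotient.mk _ q.1 : MulAction.orbitRel.Quotient G X) = Quotient.mk _ q.2} =
      ⋃ g : G, {q : X × X | g • q.1 = q.2} := by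
    ext q
    simp only [Set.mem_ofPred_eq, Set.mem_iUnion]
    rw [Quotient.eq, MulAction.orbitRel_apply, ← MulAction.mem_orbit_symm]
    rfl
  rw [this]
  exact isClosed_iUnion_of_finite fun g =>
    isClosed_eq ((continuous_const_smul g).comp continuous_fst) continuous_snd

end FiniteGroup

/-! ### The plane quotients are singular at the origin -/

open Asymptotics in
/-- A holomorphic function of one variable that vanishes at `0` and is invariant under
multiplication by a primitive `N`-th root of unity vanishes to order `N`. -/
theorem isBigO_pow_of_invariant {N : ℕ} {ζ : ℂ} (hζ : IsPrimitiveRoot ζ N) {f : ℂ → ℂ}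
    (hf : AnalyticAt ℂ f 0) (h0 : f 0 = 0) (hinv : ∀ t, f (ζ * t) = f t) :
    f =O[𝓝 0] fun t : ℂ => t ^ N := by
  rcases hf.eventually_eq_zero_or_eventually_ne_zero with h | h
  · exact (isBigO_zero _ _).congr' (h.mono fun t ht => ht.symm) .rfl
  · obtain ⟨n, g, hg, hg0, hfg⟩ := (hf.exists_eventuallyEq_pow_smul_nonzero_iff).2 (by
      intro h'
      obtain ⟨t, ht, ht'⟩ := (h.and (h'.filter_mono nhdsWithin_le_nhds)).exists
      exact ht ht')
    have hfg' : ∀ᶠ t in 𝓝 (0 : ℂ), f t = t ^ n * g t := by simpa using hfg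
    have hn : n ≠ 0 := by
      rintro rfl
      have := hfg'.self_of_nhds
      simp [h0] at this
      exact hg0 this.symm
    have hmul : Filter.Tendsto (fun t : ℂ => ζ * t) (𝓝 0) (𝓝 0) := by
      have : ContinuousAt (fun t : ℂ => ζ * t) 0 := by fun_prop
      simpa [ContinuousAt] using this
    -- With `f t = t ^ n * g t`, invariance gives `ζ ^ n * g (ζ * t) = g t` for small `t ≠ 0`; let
    -- `t` tend to `0`. Since `g 0 ≠ 0`, `N` divides the order `n`.
    have hpow : ζ ^ n * g 0 = g 0 := by
      have e₁ : Filter.Tendsto (fun t : ℂ => ζ ^ n * g (ζ * t)) (𝓝[≠] 0) (𝓝 (ζ ^ n * g 0)) :=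
        (((hg.continuousAt.tendsto.comp hmul).const_mul _)).mono_left nhdsWithin_le_nhds
      have e₂ : Filter.Tendsto g (𝓝[≠] 0) (𝓝 (g 0)) :=
        hg.continuousAt.tendsto.mono_left nhdsWithin_le_nhds
      refine tendsto_nhds_unique (e₁.congr' ?_) e₂
      filter_upwards [hfg'.filter_mono nhdsWithin_le_nhds,
        (hmul.eventually hfg').filter_mono nhdsWithin_le_nhds, self_mem_nhdsWithin] with t h₁ h₂ ht
      rw [hinv, h₁, mul_pow] at h₂
      have : t ^ n ≠ 0 := pow_ne_zero _ ht
      refine mul_left_cancel₀ this ?_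
      rw [h₂]; ring
    have hdvd : N ∣ n := hζ.dvd_of_pow_eq_one n (mul_right_cancel₀ hg0 (by rw [hpow, one_mul]))
    have hle : N ≤ n := Nat.le_of_dvd (Nat.pos_of_ne_zero hn) hdvd
    have hg' : (fun t => t ^ (n - N) * g t) =O[𝓝 0] fun _ => (1 : ℂ) :=
      ((continuousAt_id.pow _).mul hg.continuousAt).tendsto.isBigO_one ℂ
    refine (((isBigO_refl (fun t : ℂ => t ^ N) (𝓝 0)).mul hg').congr' ?_ ?_)
    · filter_upwards [hfg'] with t ht
      rw [ht, ← mul_assoc, ← pow_add, Nat.add_sub_cancel' hle]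
    · exact .of_forall fun t => by simp

-- This turns the asymptotic relations along lines into equations between coefficients.
open Asymptotics in
theorem eq_zero_of_const_mul_pow_isLittleO {c : ℂ} {n : ℕ}
    (h : (fun t : ℂ => c * t ^ n) =o[𝓝 0] fun t : ℂ => t ^ n) : c = 0 := by
  by_contra hc
  have h' : (fun t : ℂ => t ^ n) =o[𝓝[≠] 0] fun t : ℂ => t ^ n :=
    ((isLittleO_const_mul_left_iff hc).1 h).mono nhdsWithin_le_nhds
  refine isLittleO_irrefl (Filter.Eventually.frequently ?_) h'
  filter_upwards [self_mem_nhdsWithin] with t ht using pow_ne_zero n ht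

/-- If the plane quotient were nonsingular at the origin, two invariant functions would generate
the invariant functions. -/
theorem exists_generators_of_isNonsingularAt {K : Subgroup (GLin 2)}
    (hK : IsNonsingularAt 2 (planeOrigin K)) :
    ∃ φ : (Fin 2 → ℂ) → (Fin 2 → ℂ), AnalyticAt ℂ φ 0 ∧ φ 0 = 0 ∧
      (∀ g ∈ K, ∀ z, φ (g z) = φ z) ∧
      ∀ F : (Fin 2 → ℂ) → ℂ, AnalyticAt ℂ F 0 → (∀ g ∈ K, ∀ z, F (g z) = F z) →
        ∃ h : (Fin 2 → ℂ) → ℂ, AnalyticAt ℂ h 0 ∧ ∀ᶠ z in 𝓝 0, F z = h (φ z) := by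
  obtain ⟨e, h0, he0, he⟩ := hK
  have hsrc : ∀ᶠ z in 𝓝 (0 : Fin 2 → ℂ), (Quotient.mk _ z : PlaneQuotient K) ∈ e.source :=
    (continuous_quotient_mk'.continuousAt (x := (0 : Fin 2 → ℂ))).eventually
      (e.open_source.mem_nhds h0)
  -- The generators are the coordinates of the supposed smooth chart, pulled back to the plane.
  -- Factoring through the orbit space, they are invariant everywhere.
  refine ⟨fun z => e (Quotient.mk _ z), ?_, he0, ?_, ?_⟩
  · rw [analyticAt_pi_iff]
    intro i
    refine (holAt_planeQuotient_iff K (fun q => e q i) 0).1 ?_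
    refine (he _ h0 fun z => z i).1 ?_
    exact analyticAt_coord i _
  · intro g hg z
    exact congrArg e ((mk_eq_mk_iff_exists_linear K z (g z)).2 ⟨g, hg, rfl⟩).symm
  · intro F hF hinv
    let f : PlaneQuotient K → ℂ := Quotient.lift F (by
      intro a b hab
      obtain ⟨g, hg, rfl⟩ := (mk_eq_mk_iff_exists_linear K a b).1 (Quotient.sound hab)
      exact (hinv g hg a).symm)
    have hfe : ∀ᶠ z in 𝓝 (0 : Fin 2 → ℂ), F z = f (e.symm (e (Quotient.mk _ z))) := by
      filter_upwards [hsrc] with z hz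
      rw [e.left_inv hz]
      rfl
    refine ⟨fun z => f (e.symm z), ?_, hfe⟩
    have := (he _ h0 fun z => f (e.symm z)).2
      ((holAt_planeQuotient_iff K (fun q => f (e.symm (e q))) 0).2 (hF.congr hfe))
    rwa [he0] at this

open Asymptotics in
/-- If the plane quotient were nonsingular at the origin, any three invariant functions would be
linearly dependent modulo higher order terms. -/
theorem exists_relation_of_isNonsingularAt {K : Subgroup (GLin 2)}
    (hK : IsNonsingularAt 2 (planeOrigin K)) (F : Fin 3 → (Fin 2 → ℂ) → ℂ)
    (hF : ∀ i, AnalyticAt ℂ (F i) 0) (hF0 : ∀ i, F i 0 = 0)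
    (hinv : ∀ i, ∀ g ∈ K, ∀ z, F i (g z) = F i z) :
    ∃ φ : (Fin 2 → ℂ) → (Fin 2 → ℂ), AnalyticAt ℂ φ 0 ∧ φ 0 = 0 ∧
      (∀ g ∈ K, ∀ z, φ (g z) = φ z) ∧
      ∃ c : Fin 3 → ℂ, c ≠ 0 ∧ (fun z => ∑ i, c i * F i z) =o[𝓝 0] φ := by
  obtain ⟨φ, hφ, hφ0, hφK, hgen⟩ := exists_generators_of_isNonsingularAt hK
  refine ⟨φ, hφ, hφ0, hφK, ?_⟩
  choose h hh hFh using fun i => hgen (F i) (hF i) (hinv i)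
  -- Writing `F i = h i ∘ φ`, `L` sends `c` to the gradient at `0` of `∑ c i * h i`. A map from
  -- dimension three to dimension two has a nonzero kernel.
  let L : (Fin 3 → ℂ) →ₗ[ℂ] (Fin 2 → ℂ) :=
    Fintype.linearCombination ℂ fun i j => fderiv ℂ (h i) 0 (Pi.single j 1)
  obtain ⟨c, hc, hc0⟩ : ∃ c ∈ LinearMap.ker L, c ≠ 0 :=
    (Submodule.ne_bot_iff _).1 (LinearMap.ker_ne_bot_of_finrank_lt (by simp))
  refine ⟨c, hc0, ?_⟩
  have hD : HasFDerivAt (fun z => ∑ i, c i * h i z) (0 : (Fin 2 → ℂ) →L[ℂ] ℂ) 0 := by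
    have hd : HasFDerivAt (fun z => ∑ i, c i * h i z) (∑ i, c i • fderiv ℂ (h i) 0) 0 :=
      HasFDerivAt.fun_sum fun i _ => (hh i).differentiableAt.hasFDerivAt.const_mul (c i)
    convert hd
    refine ContinuousLinearMap.coe_injective (LinearMap.pi_ext' fun j => LinearMap.ext_ring ?_)
    have := congrFun (LinearMap.mem_ker.1 hc) j
    simpa [L, Fintype.linearCombination_apply, Finset.sum_apply] using this.symm
  have hh0 : ∀ i, h i 0 = 0 := by
    intro i
    have := (hFh i).self_of_nhds
    rw [hF0, hφ0] at this
    exact this.symm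
  have ho : (fun z => ∑ i, c i * h i z) =o[𝓝 0] fun z : Fin 2 → ℂ => z := by
    have := hD.isLittleO
    simpa [hh0] using this
  have hφt : Filter.Tendsto φ (𝓝 0) (𝓝 0) := by
    have := hφ.continuousAt.tendsto
    rwa [hφ0] at this
  refine (ho.comp_tendsto hφt).congr' ?_ .rfl
  filter_upwards [Filter.eventually_all.2 hFh] with z hz
  simp [hz]

/-! ### Diagonal actions and the two cyclic quotient singularities -/

@[simp]
theorem diag_apply {n : ℕ} (t : Fin n → ℂˣ) (x : Fin n → ℂ) (i : Fin n) :
    diag t x i = t i * x i := rfl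

theorem diag_pair_apply (u v : ℂˣ) (x : Fin 2 → ℂ) :
    diag ![u, v] x = ![u * x 0, v * x 1] := by
  ext i
  fin_cases i <;> rfl

theorem isPrimitiveRoot_omega {N : ℕ} (hN : N ≠ 0) : IsPrimitiveRoot (omega N : ℂ) N :=
  Complex.isPrimitiveRoot_exp N hN

theorem invariant_of_mem_zpowers {α β : Type*} [Group α] [MulAction α β] {γ : Type*} {F : β → γ}
    {g : α} (h : ∀ z, F (g • z) = F z) : ∀ k ∈ Subgroup.zpowers g, ∀ z, F (k • z) = F z := by
  let S : Subgroup α :=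
    { carrier := {k | ∀ z, F (k • z) = F z}
      mul_mem' := fun {a b} ha hb z => by rw [mul_smul, ha, hb]
      one_mem' := fun z => by rw [one_smul]
      inv_mem' := fun {a} ha z => by rw [← ha (a⁻¹ • z), smul_inv_smul] }
  exact fun k hk => (Subgroup.zpowers_le.2 (show g ∈ S from h)) hk

open Asymptotics in
/-- The order of vanishing of an invariant map along a line on which a group element acts by a
primitive root of unity. -/
theorem isBigO_pow_line {N : ℕ} {ζ : ℂ} (hζ : IsPrimitiveRoot ζ N)
    {φ : (Fin 2 → ℂ) → (Fin 2 → ℂ)} (hφ : AnalyticAt ℂ φ 0) (hφ0 : φ 0 = 0) {g : GLin 2}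
    (hinv : ∀ z, φ (g z) = φ z) {w : Fin 2 → ℂ} (hw : g w = ζ • w) :
    (fun t : ℂ => φ (t • w)) =O[𝓝 0] fun t : ℂ => t ^ N := by
  rw [isBigO_pi]
  intro i
  have hφ' : AnalyticAt ℂ φ ((0 : ℂ) • w) := by simpa using hφ
  have hline : AnalyticAt ℂ (fun t : ℂ => φ (t • w)) 0 :=
    AnalyticAt.comp (g := φ) (f := fun t : ℂ => t • w) hφ' (by fun_prop)
  refine isBigO_pow_of_invariant hζ (analyticAt_pi_iff.1 hline i) (by simp [hφ0]) fun t => ?_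
  rw [← hinv (t • w), map_smul, hw, smul_smul, mul_comm]

theorem tendsto_line (w : Fin 2 → ℂ) :
    Filter.Tendsto (fun t : ℂ => t • w) (𝓝 0) (𝓝 0) := by
  have : ContinuousAt (fun t : ℂ => t • w) 0 := by fun_prop
  simpa [ContinuousAt] using this

theorem not_isNonsingularAt_scalar {N : ℕ} (hN : 2 ≤ N) :
    ¬ IsNonsingularAt 2 (planeOrigin (scalarGroup N)) := by
  intro hK
  have hN0 : N ≠ 0 := by lia
  have hω := isPrimitiveRoot_omega hN0
  obtain ⟨φ, hφ, hφ0, hφK, c, hc, ho⟩ := exists_relation_of_isNonsingularAt hK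
    ![fun z => z 0 ^ N, fun z => z 0 ^ (N - 1) * z 1, fun z => z 1 ^ N]
    (by
      have h0 := analyticAt_coord 0 (0 : Fin 2 → ℂ)
      have h1 := analyticAt_coord 1 (0 : Fin 2 → ℂ)
      intro i
      fin_cases i
      exacts [h0.pow _, (h0.pow _).mul h1, h1.pow _])
    (by intro i; fin_cases i <;> simp [hN0])
    (by
      intro i
      refine invariant_of_mem_zpowers fun z => ?_
      have h1 : (omega N : ℂ) ^ (N - 1) * omega N = 1 := by
        rw [← pow_succ, Nat.sub_add_cancel (by lia), hω.pow_eq_one]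
      change _ = (![fun z => z 0 ^ N, fun z => z 0 ^ (N - 1) * z 1, fun z => z 1 ^ N] :
        Fin 3 → (Fin 2 → ℂ) → ℂ) i z
      fin_cases i <;> simp [mul_pow, hω.pow_eq_one]
      linear_combination (z 0 ^ (N - 1) * z 1) * h1)
  -- Every line is an eigenline with eigenvalue `ω`, so `φ (t • w) = O(t ^ N)`. The three monomials
  -- have degree `N`, so the combination is a constant times `t ^ N` and also `o(t ^ N)`.
  have key : ∀ w : Fin 2 → ℂ, c 0 * w 0 ^ N + c 1 * (w 0 ^ (N - 1) * w 1) + c 2 * w 1 ^ N = 0 := by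
    intro w
    have hO := isBigO_pow_line hω hφ hφ0 (hφK _ (Subgroup.mem_zpowers _)) (w := w) (by
      ext i; fin_cases i <;> rfl)
    refine eq_zero_of_const_mul_pow_isLittleO (n := N)
      (((ho.comp_tendsto (tendsto_line w)).trans_isBigO hO).congr_left fun t => ?_)
    have : t ^ N = t ^ (N - 1) * t := by rw [← pow_succ, Nat.sub_add_cancel (by lia)]
    simp [Fin.sum_univ_three, mul_pow]
    linear_combination (-(c 1) * w 0 ^ (N - 1) * w 1) * this
  have hN1 : N - 1 ≠ 0 := by lia
  have k₀ : c 0 = 0 := by simpa [hN0, hN1] using key ![1, 0]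
  have k₂ : c 2 = 0 := by simpa [hN0, hN1] using key ![0, 1]
  have k₁ : c 1 = 0 := by simpa [k₀, k₂] using key ![1, 1]
  exact hc (by ext i; fin_cases i <;> simp [k₀, k₁, k₂])

-- The terms of degree zero and one of the power series vanish.
open Asymptotics in
theorem isBigO_norm_sq_of_fderiv_eq_zero {φ : (Fin 2 → ℂ) → (Fin 2 → ℂ)} (hφ : AnalyticAt ℂ φ 0)
    (hφ0 : φ 0 = 0) (hd : fderiv ℂ φ 0 = 0) : φ =O[𝓝 0] fun z => ‖z‖ ^ 2 := by
  obtain ⟨p, hp⟩ := hφ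
  have h := hp.isBigO_sub_partialSum_pow 2
  refine h.congr_left fun y => ?_
  have h0 : p 0 (fun _ => y) = 0 := (hp.coeff_zero _).trans hφ0
  have h1 : p 1 (fun _ => y) = 0 := by
    have := hp.fderiv_eq
    rw [hd] at this
    have := congrArg (fun L => L y) this.symm
    have hy : (fun _ => y : Fin 1 → Fin 2 → ℂ) = ![y] := by ext i; fin_cases i; rfl
    rw [hy]
    simpa [continuousMultilinearCurryFin1_apply] using this
  simp [FormalMultilinearSeries.partialSum, Finset.sum_range_succ, h0, h1]

open Asymptotics in
theorem not_isNonsingularAt_typeA {N : ℕ} (hN : 2 ≤ N) :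
    ¬ IsNonsingularAt 2 (planeOrigin (typeAGroup N)) := by
  intro hK
  have hN0 : N ≠ 0 := by lia
  have hω := isPrimitiveRoot_omega hN0
  obtain ⟨φ, hφ, hφ0, hφK, c, hc, ho⟩ := exists_relation_of_isNonsingularAt hK
    ![fun z => z 0 ^ N, fun z => z 0 * z 1, fun z => z 1 ^ N]
    (by
      have h0 := analyticAt_coord 0 (0 : Fin 2 → ℂ)
      have h1 := analyticAt_coord 1 (0 : Fin 2 → ℂ)
      intro i
      fin_cases i
      exacts [h0.pow _, h0.mul h1, h1.pow _])
    (by intro i; fin_cases i <;> simp [hN0])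
    (by
      intro i
      refine invariant_of_mem_zpowers fun z => ?_
      have h1 : (omega N : ℂ) * (omega N : ℂ)⁻¹ = 1 := mul_inv_cancel₀ (omega N).ne_zero
      change _ = (![fun z => z 0 ^ N, fun z => z 0 * z 1, fun z => z 1 ^ N] :
        Fin 3 → (Fin 2 → ℂ) → ℂ) i z
      fin_cases i <;> simp [mul_pow, hω.pow_eq_one]
      linear_combination (z 0 * z 1) * h1)
  have hinv := hφK _ (Subgroup.mem_zpowers _)
  have hline : ∀ w : Fin 2 → ℂ, (fun t : ℂ => c 0 * (t * w 0) ^ N + c 1 * (t * w 0 * (t * w 1)) +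
      c 2 * (t * w 1) ^ N) =o[𝓝 0] fun t => φ (t • w) := fun w =>
    (ho.comp_tendsto (tendsto_line w)).congr_left fun t => by simp [Fin.sum_univ_three]
  have e₀ : diag ![omega N, (omega N)⁻¹] ![1, 0] = (omega N : ℂ) • ![1, 0] := by
    rw [diag_pair_apply]; simp
  have e₁ : diag ![omega N, (omega N)⁻¹] ![0, 1] = (omega N : ℂ)⁻¹ • ![0, 1] := by
    rw [diag_pair_apply]; simp
  -- On a coordinate axis only one of the three monomials survives, and `φ = O(t ^ N)` because the
  -- generator acts there by a primitive root.
  have k₀ : c 0 = 0 := by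
    have hO := isBigO_pow_line hω hφ hφ0 hinv e₀
    refine eq_zero_of_const_mul_pow_isLittleO (n := N)
      (((hline _).trans_isBigO hO).congr_left fun t => ?_)
    simp [hN0]
  have k₂ : c 2 = 0 := by
    have hO := isBigO_pow_line hω.inv hφ hφ0 hinv e₁
    refine eq_zero_of_const_mul_pow_isLittleO (n := N)
      (((hline _).trans_isBigO hO).congr_left fun t => ?_)
    simp [hN0]
  -- Differentiating `φ ∘ G = φ` at `0` shows that the derivative kills every eigenvector of `G`
  -- with eigenvalue different from `1`, and the axes span the plane.
  have hd : fderiv ℂ φ 0 = 0 := by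
    have hφd := hφ.differentiableAt.hasFDerivAt
    let G := LinearMap.toContinuousLinearMap
      (diag ![omega N, (omega N)⁻¹] : (Fin 2 → ℂ) →ₗ[ℂ] (Fin 2 → ℂ))
    have hcomp : HasFDerivAt (fun z => φ (G z)) ((fderiv ℂ φ 0).comp G) 0 := by
      refine HasFDerivAt.comp (g := φ) 0 ?_ G.hasFDerivAt
      simpa using hφd
    have heq : (fderiv ℂ φ 0).comp G = fderiv ℂ φ 0 := by
      refine HasFDerivAt.unique ?_ hφd
      exact hcomp.congr_of_eventuallyEq (.of_forall fun z => (hinv z).symm)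
    have eig : ∀ (ζ : ℂ) (w : Fin 2 → ℂ), ζ ≠ 1 → diag ![omega N, (omega N)⁻¹] w = ζ • w →
        fderiv ℂ φ 0 w = 0 := by
      intro ζ w hζ hw
      have h₁ : fderiv ℂ φ 0 (diag ![omega N, (omega N)⁻¹] w) = fderiv ℂ φ 0 w :=
        congrArg (fun L => L w) heq
      rw [hw, map_smul] at h₁
      have h₂ : (ζ - 1) • fderiv ℂ φ 0 w = 0 := by rw [sub_smul, h₁, one_smul, sub_self]
      exact (smul_eq_zero.1 h₂).resolve_left (sub_ne_zero.2 hζ)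
    have hω1 : (omega N : ℂ) ≠ 1 := hω.ne_one (by lia)
    ext1 w
    have hw : w = w 0 • ![1, 0] + w 1 • ![0, 1] := by
      ext i; fin_cases i <;> simp
    rw [hw, map_add, map_smul, map_smul, eig _ _ hω1 e₀,
      eig _ _ (by simpa using hω1) e₁]
    simp
  -- On the diagonal the remaining term is `c 1 * t ^ 2`, while `φ = O(t ^ 2)`.
  have k₁ : c 1 = 0 := by
    have hO : (fun t : ℂ => φ (t • ![1, 1])) =O[𝓝 0] fun t : ℂ => t ^ 2 := by
      have := (isBigO_norm_sq_of_fderiv_eq_zero hφ hφ0 hd).comp_tendsto (tendsto_line ![1, 1])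
      refine this.trans (IsBigO.of_bound 1 (.of_forall fun t => ?_))
      have : ‖t • (![1, 1] : Fin 2 → ℂ)‖ ≤ ‖t‖ :=
        (pi_norm_le_iff_of_nonneg (norm_nonneg t)).2 fun i => by fin_cases i <;> simp
      simpa using pow_le_pow_left₀ (norm_nonneg _) this 2
    refine eq_zero_of_const_mul_pow_isLittleO (n := 2)
      (((hline _).trans_isBigO hO).congr_left fun t => ?_)
    simp [k₀, k₂, sq]
  exact hc (by ext i; fin_cases i <;> simp [k₀, k₁, k₂])

/-! ### The topology of projective space -/

section Projective

variable {n : ℕ}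

theorem continuous_coord (i : Fin n) : Continuous fun v : {v : Fin n → ℂ // v ≠ 0} => v.1 i :=
  (continuous_apply i).comp continuous_subtype_val

theorem continuous_projMk :
    Continuous (Projectivization.mk' ℂ : {v : Fin n → ℂ // v ≠ 0} → ℙ ℂ (Fin n → ℂ)) :=
  continuous_quotient_mk' (s := projectivizationSetoid ℂ (Fin n → ℂ))

theorem isOpenQuotientMap_projMk :
    IsOpenQuotientMap (Projectivization.mk' ℂ : {v : Fin n → ℂ // v ≠ 0} → ℙ ℂ (Fin n → ℂ)) := by
  refine ⟨?_, continuous_projMk, ?_⟩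
  · intro p
    exact ⟨⟨p.rep, p.rep_nonzero⟩, p.mk_rep⟩
  · intro U hU
    refine (isQuotientMap_quotient_mk' (s := projectivizationSetoid ℂ (Fin n → ℂ))).isOpen_preimage.1
      ?_
    let m : ℂˣ → {v : Fin n → ℂ // v ≠ 0} → {v : Fin n → ℂ // v ≠ 0} := fun a v =>
      ⟨a • v.1, (smul_ne_zero_iff_ne a).2 v.2⟩
    have hm : ∀ a, Continuous (m a) := fun a =>
      (continuous_subtype_val.const_smul (a : ℂ)).subtype_mk _
    have : Quotient.mk (projectivizationSetoid ℂ (Fin n → ℂ)) ⁻¹' (Projectivization.mk' ℂ '' U) =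
        -- The saturation of an open set is the union of its translates by scalars.
        ⋃ a, m a ⁻¹' U := by
      ext v
      simp only [Set.mem_preimage, Set.mem_iUnion]
      constructor
      · rintro ⟨w, hw, hwv⟩
        obtain ⟨a, ha⟩ := (Projectivization.mk_eq_mk_iff ℂ w.1 v.1 w.2 v.2).1 hwv
        refine ⟨a, ?_⟩
        convert hw
        exact Subtype.ext ha
      · rintro ⟨a, ha⟩
        exact ⟨m a v, ha, (Projectivization.mk_eq_mk_iff ℂ _ v.1 _ v.2).2 ⟨a, rfl⟩⟩
    exact this ▸ isOpen_iUnion fun a => hU.preimage (hm a)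

/-- Vanishing minors are a closed condition, which makes projective space Hausdorff. -/
theorem mk_eq_mk_iff_minors {v w : Fin n → ℂ} (hv : v ≠ 0) (hw : w ≠ 0) :
    Projectivization.mk ℂ v hv = Projectivization.mk ℂ w hw ↔ ∀ i j, v i * w j = v j * w i := by
  rw [Projectivization.mk_eq_mk_iff']
  constructor
  · rintro ⟨a, rfl⟩ i j
    simp only [Pi.smul_apply, smul_eq_mul]
    ring
  · intro h
    obtain ⟨j, hj⟩ := Function.ne_iff.1 hw
    have hj : w j ≠ 0 := hj
    refine ⟨v j / w j, ?_⟩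
    ext i
    have := h i j
    simp only [Pi.smul_apply, smul_eq_mul]
    rw [div_mul_eq_mul_div, div_eq_iff hj, this]

instance projT2Space : T2Space (ℙ ℂ (Fin n → ℂ)) := by
  rw [t2Space_iff_of_isOpenQuotientMap isOpenQuotientMap_projMk]
  simp only [Projectivization.mk'_eq_mk, mk_eq_mk_iff_minors, Set.ofPred_forall]
  refine isClosed_iInter fun i => isClosed_iInter fun j => isClosed_eq ?_ ?_
  · exact ((continuous_coord i).comp continuous_fst).mul ((continuous_coord j).comp continuous_snd)
  · exact ((continuous_coord j).comp continuous_fst).mul ((continuous_coord i).comp continuous_snd)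

instance projSecondCountable : SecondCountableTopology (ℙ ℂ (Fin n → ℂ)) :=
  isOpenQuotientMap_projMk.isQuotientMap.secondCountableTopology isOpenQuotientMap_projMk.isOpenMap

theorem continuous_proj_smul (g : GLin n) : Continuous fun p : ℙ ℂ (Fin n → ℂ) => g • p := by
  rw [← isOpenQuotientMap_projMk.continuous_comp_iff]
  have hg : Continuous fun v : Fin n → ℂ => g v :=
    continuous_iff_continuousAt.2 fun x => (analyticAt_linear g x).continuousAt
  exact continuous_projMk.comp
    ((hg.comp continuous_subtype_val).subtype_mk fun v => (smul_ne_zero_iff_ne g).2 v.2)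

theorem eventually_mk_mem {U : Set (ℙ ℂ (Fin n → ℂ))} (hU : IsOpen U) {v : Fin n → ℂ} (hv : v ≠ 0)
    (hvU : Projectivization.mk ℂ v hv ∈ U) :
    ∀ᶠ w in 𝓝 v, ∀ hw : w ≠ 0, Projectivization.mk ℂ w hw ∈ U := by
  have h : ∀ᶠ w : {v : Fin n → ℂ // v ≠ 0} in 𝓝 ⟨v, hv⟩, Projectivization.mk' ℂ w ∈ U :=
    (hU.preimage continuous_projMk).mem_nhds hvU
  rw [nhds_subtype_eq_comap, Filter.eventually_comap] at h
  filter_upwards [h] with w hw hw0 using hw ⟨w, hw0⟩ rfl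

/-- The ratio of two homogeneous coordinates. -/
def coordRatio (r l : Fin n) (p : ℙ ℂ (Fin n → ℂ)) : ℂ := p.rep r / p.rep l

@[simp]
theorem coordRatio_mk (r l : Fin n) {v : Fin n → ℂ} (hv : v ≠ 0) :
    coordRatio r l (Projectivization.mk ℂ v hv) = v r / v l := by
  obtain ⟨a, ha⟩ := Projectivization.exists_smul_eq_mk_rep ℂ v hv
  rw [coordRatio, ← ha]
  simp [Units.smul_def, mul_div_mul_left]

theorem mk_rep_apply_eq_zero_iff (l : Fin n) {v : Fin n → ℂ} (hv : v ≠ 0) :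
    (Projectivization.mk ℂ v hv).rep l = 0 ↔ v l = 0 := by
  obtain ⟨a, ha⟩ := Projectivization.exists_smul_eq_mk_rep ℂ v hv
  rw [← ha]
  simp [Units.smul_def]

theorem isOpen_rep_apply_ne_zero (l : Fin n) : IsOpen {p : ℙ ℂ (Fin n → ℂ) | p.rep l ≠ 0} := by
  rw [← isOpenQuotientMap_projMk.isQuotientMap.isOpen_preimage]
  have : Projectivization.mk' ℂ ⁻¹' {p : ℙ ℂ (Fin n → ℂ) | p.rep l ≠ 0} = {v | v.1 l ≠ 0} := by
    ext v
    simp [mk_rep_apply_eq_zero_iff]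
  rw [this]
  exact isOpen_ne_fun (continuous_coord l) continuous_const

theorem continuousOn_coordRatio (r l : Fin n) :
    ContinuousOn (coordRatio r l) {p : ℙ ℂ (Fin n → ℂ) | p.rep l ≠ 0} := by
  intro p hp
  obtain ⟨v, rfl⟩ := isOpenQuotientMap_projMk.surjective p
  refine ContinuousAt.continuousWithinAt ?_
  rw [← isOpenQuotientMap_projMk.continuousAt_comp_iff]
  have : (coordRatio r l ∘ Projectivization.mk' ℂ) = fun v : {v : Fin n → ℂ // v ≠ 0} =>
      v.1 r / v.1 l := by
    ext v
    simp
  rw [this]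
  have hl : v.1 l ≠ 0 := by simpa [mk_rep_apply_eq_zero_iff] using hp
  exact (continuous_coord r).continuousAt.div (continuous_coord l).continuousAt hl

end Projective

/-! ### The symmetry group as a quotient of a finite torus -/

theorem diag_mul {n : ℕ} (s t : Fin n → ℂˣ) : diag (s * t) = diag s * diag t := by
  ext x i
  simp [mul_assoc]

theorem diag_one {n : ℕ} : diag (1 : Fin n → ℂˣ) = 1 := by
  ext x i
  simp

/-- The diagonal matrices with entries `N`-th roots of unity that act on the Fermat surface
through `H`. -/
def torus (N : ℕ) : Subgroup (Fin 4 → ℂˣ) where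
  carrier := {t | (∀ i, t i ^ N = 1) ∧ t 0 * t 1 = t 2 * t 3}
  mul_mem' := by
    rintro s t ⟨hs, hs'⟩ ⟨ht, ht'⟩
    refine ⟨fun i => by rw [Pi.mul_apply, mul_pow, hs, ht, one_mul], ?_⟩
    simp only [Pi.mul_apply]
    rw [mul_mul_mul_comm, hs', ht', mul_mul_mul_comm]
  one_mem' := by simp
  inv_mem' := by
    rintro t ⟨ht, ht'⟩
    refine ⟨fun i => by rw [Pi.inv_apply, inv_pow, ht, inv_one], ?_⟩
    simp only [Pi.inv_apply]
    rw [← mul_inv, ht', mul_inv]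

theorem torus_pow_eq_one {N : ℕ} {t : Fin 4 → ℂˣ} (ht : t ∈ torus N) (i : Fin 4) :
    (t i : ℂ) ^ N = 1 := by
  rw [← Units.val_pow_eq_pow_val, ht.1 i, Units.val_one]

theorem torus_pow_two_mul {N : ℕ} {t : Fin 4 → ℂˣ} (ht : t ∈ torus N) (i : Fin 4) :
    (t i : ℂ) ^ (2 * N) = 1 := by
  rw [mul_comm, pow_mul, torus_pow_eq_one ht, one_pow]

theorem finite_torus {N : ℕ} (hN : N ≠ 0) : Finite (torus N) := by
  have : NeZero N := ⟨hN⟩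
  have hfin : Finite (rootsOfUnity N ℂ) := inferInstance
  have h : Set.Finite {u : ℂˣ | u ^ N = 1} :=
    (@Set.toFinite _ (rootsOfUnity N ℂ : Set ℂˣ) hfin).subset fun u hu => hu
  refine ((Set.Finite.pi' fun _ : Fin 4 => h).subset ?_).to_subtype
  exact fun t ht => ht.1

/-- The action of the finite torus on the Fermat surface. -/
def torusAut (N : ℕ) : torus N →* Equiv.Perm (Fermat N) where
  toFun t := diagAut N t.1 (torus_pow_two_mul t.2)
  map_one' := by
    ext p
    change diag (1 : Fin 4 → ℂˣ) • p.1 = p.1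
    rw [diag_one, one_smul]
  map_mul' s t := by
    ext p
    change diag (s.1 * t.1) • p.1 = diag s.1 • diag t.1 • p.1
    rw [diag_mul, mul_smul]

theorem torusAut_apply {N : ℕ} (t : torus N) (p : Fermat N) :
    (torusAut N t p).1 = diag t.1 • p.1 := rfl

theorem exists_omega_pow_eq {N : ℕ} (hN : N ≠ 0) {u : ℂˣ} (hu : u ^ N = 1) :
    ∃ k : ℕ, omega N ^ k = u := by
  have : NeZero N := ⟨hN⟩
  obtain ⟨k, -, hk⟩ := (isPrimitiveRoot_omega hN).eq_pow_of_pow_eq_one (ξ := (u : ℂ)) (by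
    rw [← Units.val_pow_eq_pow_val, hu, Units.val_one])
  exact ⟨k, Units.ext (by simpa using hk)⟩

theorem omega_pow_eq_one {N : ℕ} (hN : N ≠ 0) : omega N ^ N = 1 := by
  ext
  simpa using (isPrimitiveRoot_omega hN).pow_eq_one

/-- `V₀ ^ i * V₁ ^ j` has the entries `ω ^ (i + j), 1, ω ^ i, ω ^ j`. Dividing a torus element by
its entry `t 1` brings it to this form: the last two entries determine `i` and `j`, and the relation
gives the first. -/
theorem H_eq_range {N : ℕ} (hN : N ≠ 0) : H N = (torusAut N).range := by
  have hω := omega_pow_eq_one hN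
  have m₀ : ![omega N, 1, omega N, 1] ∈ torus N :=
    ⟨fun i => by fin_cases i <;> simp [hω], by simp⟩
  have m₁ : ![omega N, 1, 1, omega N] ∈ torus N :=
    ⟨fun i => by fin_cases i <;> simp [hω], by simp⟩
  apply le_antisymm
  · rw [H, Subgroup.closure_le]
    rintro g (rfl | rfl)
    · exact ⟨⟨_, m₀⟩, rfl⟩
    · exact ⟨⟨_, m₁⟩, rfl⟩
  · rintro _ ⟨⟨t, ht⟩, rfl⟩
    obtain ⟨i, hi⟩ := exists_omega_pow_eq hN (u := t 2 / t 1) (by rw [div_pow, ht.1, ht.1, div_one])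
    obtain ⟨j, hj⟩ := exists_omega_pow_eq hN (u := t 3 / t 1) (by rw [div_pow, ht.1, ht.1, div_one])
    have key : torusAut N ⟨t, ht⟩ = V₀ N ^ i * V₁ N ^ j := by
      have e : V₀ N ^ i * V₁ N ^ j = torusAut N (⟨_, m₀⟩ ^ i * ⟨_, m₁⟩ ^ j) := by
        rw [map_mul, map_pow, map_pow]; rfl
      rw [e]
      ext p
      rw [torusAut_apply, torusAut_apply]
      obtain ⟨p, hp⟩ := p
      induction p with | h v hv =>
      change diag t • Projectivization.mk ℂ v hv = diag _ • Projectivization.mk ℂ v hv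
      rw [Projectivization.smul_mk, Projectivization.smul_mk, Projectivization.mk_eq_mk_iff]
      refine ⟨t 1, ?_⟩
      have h01 : t 1 * (omega N ^ i * omega N ^ j) = t 0 := by
        rw [hi, hj]
        have h2 : t 2 * t 3 = t 0 * t 1 := ht.2.symm
        calc t 1 * (t 2 / t 1 * (t 3 / t 1)) = (t 2 * t 3) * (t 1)⁻¹ := by
              rw [div_eq_mul_inv, div_eq_mul_inv]
              calc _ = (t 1 * (t 1)⁻¹) * (t 2 * t 3 * (t 1)⁻¹) := by ac_rfl
                _ = _ := by rw [mul_inv_cancel, one_mul]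
          _ = t 0 := by rw [h2, mul_inv_cancel_right]
      have h2 : t 1 * omega N ^ i = t 2 := by rw [hi, mul_div_cancel]
      have h3 : t 1 * omega N ^ j = t 3 := by rw [hj, mul_div_cancel]
      have h01' := congrArg Units.val h01
      have h2' := congrArg Units.val h2
      have h3' := congrArg Units.val h3
      push_cast at h01' h2' h3'
      ext r
      change (t 1 : ℂ) * (((![omega N, 1, omega N, 1] ^ i * ![omega N, 1, 1, omega N] ^ j) r : ℂˣ)
        * v r) = t r * v r
      fin_cases r <;> simp <;> rw [← mul_assoc]
      · rw [h01']
      · rw [h2']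
      · rw [h3']
    rw [key]
    exact mul_mem (pow_mem (Subgroup.subset_closure (by simp)) _)
      (pow_mem (Subgroup.subset_closure (by simp)) _)

theorem finite_H {N : ℕ} (hN : N ≠ 0) : Finite (H N) := by
  have := finite_torus hN
  rw [H_eq_range hN]
  exact Set.finite_range (torusAut N)

theorem exists_smul_iff {N : ℕ} (hN : N ≠ 0) (p q : Fermat N) :
    (∃ h : H N, h • p = q) ↔ ∃ t : torus N, torusAut N t p = q := by
  constructor
  · rintro ⟨⟨h, hh⟩, rfl⟩
    rw [H_eq_range hN] at hh
    obtain ⟨t, rfl⟩ := hh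
    exact ⟨t, rfl⟩
  · rintro ⟨t, rfl⟩
    exact ⟨⟨torusAut N t, by rw [H_eq_range hN]; exact ⟨t, rfl⟩⟩, rfl⟩

theorem continuous_torusAut {N : ℕ} (t : torus N) : Continuous (torusAut N t) :=
  ((continuous_proj_smul (diag t.1)).comp continuous_subtype_val).subtype_mk _

theorem continuousConstSMul_H {N : ℕ} (hN : N ≠ 0) : ContinuousConstSMul (H N) (Fermat N) where
  continuous_const_smul := by
    rintro ⟨h, hh⟩
    rw [H_eq_range hN] at hh
    obtain ⟨t, rfl⟩ := hh
    exact continuous_torusAut t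

theorem holAt_comp_torusAut {N : ℕ} (t : torus N) (p : Fermat N) (f : Fermat N → ℂ)
    (hf : HolSpace.holAt f (torusAut N t p)) :
    HolSpace.holAt (fun q => f (torusAut N t q)) p := by
  intro v hv hvp
  obtain ⟨g, hg, hgf⟩ := hf (diag t.1 v) ((smul_ne_zero_iff_ne (diag t.1)).2 hv) (by
    rw [torusAut_apply, ← hvp]; rfl)
  have ha := analyticAt_linear (diag t.1) v
  refine ⟨fun w => g (diag t.1 w), AnalyticAt.comp (g := g) hg ha, ?_⟩
  filter_upwards [ha.continuousAt.eventually hgf] with w hw hw0 hwZ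
  exact hw ((smul_ne_zero_iff_ne (diag t.1)).2 hw0) (torusAut N t ⟨_, hwZ⟩).2

theorem holAt_smul_H {N : ℕ} (hN : N ≠ 0) (h : H N) (p : Fermat N) (f : Fermat N → ℂ) :
    HolSpace.holAt f (h • p) ↔ HolSpace.holAt (fun q => f (h • q)) p := by
  obtain ⟨h, hh⟩ := h
  rw [H_eq_range hN] at hh
  obtain ⟨t, rfl⟩ := hh
  refine ⟨holAt_comp_torusAut t p f, fun hf => ?_⟩
  have hinv : ∀ s : torus N, ∀ q, torusAut N s⁻¹ (torusAut N s q) = q := fun s q => by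
    rw [← Equiv.Perm.mul_apply, ← map_mul, inv_mul_cancel, map_one, Equiv.Perm.one_apply]
  have := holAt_comp_torusAut t⁻¹ (torusAut N t p) (fun q => f (torusAut N t q)) (by
    rw [hinv]
    exact hf)
  have hinv' : ∀ q, torusAut N t (torusAut N t⁻¹ q) = q := fun q => by
    simp
  simp only [hinv'] at this
  exact this

/-! ### Local parametrizations of the Fermat surface -/

/-- The signs of the coordinates in the equation of the Fermat surface. -/
def fermatSign : Fin 4 → ℂ := ![1, -1, 1, -1]

theorem fermatSign_mul_self (r : Fin 4) : fermatSign r * fermatSign r = 1 := by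
  fin_cases r <;> simp [fermatSign]

theorem mk_mem_projZeros_fermatEq {N : ℕ} {v : Fin 4 → ℂ} (hv : v ≠ 0) :
    Projectivization.mk ℂ v hv ∈ projZeros (fermatEq N) ↔
      ∑ r, fermatSign r * v r ^ (2 * N) = 0 := by
  obtain ⟨a, ha⟩ := Projectivization.exists_smul_eq_mk_rep ℂ v hv
  have ha0 : (a : ℂ) ^ (2 * N) ≠ 0 := pow_ne_zero _ a.ne_zero
  simp only [projZeros, fermatEq, Set.mem_ofPred_eq, Fin.forall_fin_one, Matrix.cons_val_fin_one,
    map_sub, map_add, map_pow, MvPolynomial.eval_X, ← ha, Pi.smul_apply, Units.smul_def,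
    smul_eq_mul, mul_pow, ← mul_add, ← mul_sub, mul_eq_zero, ha0, false_or]
  rw [Fin.sum_univ_four]
  simp only [fermatSign, Matrix.cons_val]
  constructor <;> intro h <;> linear_combination h

theorem sum_fermatSign_rep {N : ℕ} (p : Fermat N) :
    ∑ r, fermatSign r * p.1.rep r ^ (2 * N) = 0 :=
  (mk_mem_projZeros_fermatEq p.1.rep_nonzero).1 (by rw [p.1.mk_rep]; exact p.2)

/-- The `n`-th power map has a holomorphic inverse near a nonzero point. -/
theorem exists_root_branch {n : ℕ} (hn : n ≠ 0) {a : ℂ} (ha : a ≠ 0) :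
    ∃ P : OpenPartialHomeomorph ℂ ℂ, a ∈ P.source ∧ (∀ z, P z = z ^ n) ∧
      ∀ w ∈ P.target, AnalyticAt ℂ P.symm w := by
  have hd : HasStrictDerivAt (fun z : ℂ => z ^ n) (n * a ^ (n - 1)) a := hasStrictDerivAt_pow n a
  have h0 : (n : ℂ) * a ^ (n - 1) ≠ 0 := mul_ne_zero (by exact_mod_cast hn) (pow_ne_zero _ ha)
  let Q := (hd.hasStrictFDerivAt_equiv h0).toOpenPartialHomeomorph (fun z : ℂ => z ^ n)
  -- Removing `0` keeps the derivative nonzero on the whole source, so the inverse is analytic on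
  -- the whole target.
  let P := Q.restrOpen {0}ᶜ isOpen_compl_singleton
  have hQ : ∀ z, P z = z ^ n := fun z => rfl
  refine ⟨P, ⟨(hd.hasStrictFDerivAt_equiv h0).mem_toOpenPartialHomeomorph_source, ha⟩, hQ, ?_⟩
  intro w hw
  have hs : P.symm w ≠ 0 := (P.map_target hw).2
  refine ContDiffAt.analyticAt ?_
  refine P.contDiffAt_symm_deriv (f₀' := n * P.symm w ^ (n - 1))
    (mul_ne_zero (by exact_mod_cast hn) (pow_ne_zero _ hs)) hw (hasDerivAt_pow n _) ?_
  exact (contDiff_id.pow n).contDiffAt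

/-- The vector with coordinates `x 0, x 1, 1, ζ` at the places `s 0, s 1, s 2, s 3`. -/
def chartVec (s : Equiv.Perm (Fin 4)) (x : Fin 2 → ℂ) (ζ : ℂ) : Fin 4 → ℂ :=
  fun r => ![x 0, x 1, 1, ζ] (s.symm r)

theorem chartVec_apply (s : Equiv.Perm (Fin 4)) (x : Fin 2 → ℂ) (ζ : ℂ) (k : Fin 4) :
    chartVec s x ζ (s k) = ![x 0, x 1, 1, ζ] k := by
  simp [chartVec]

theorem chartVec_ne_zero (s : Equiv.Perm (Fin 4)) (x : Fin 2 → ℂ) (ζ : ℂ) :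
    chartVec s x ζ ≠ 0 := by
  intro h
  have := congrFun h (s 2)
  simp [chartVec_apply] at this

/-- The `2N`-th power of the last coordinate as a function of the first two, the third being
`1`. -/
def lastPow (N : ℕ) (s : Equiv.Perm (Fin 4)) (x : Fin 2 → ℂ) : ℂ :=
  -fermatSign (s 3) * (fermatSign (s 0) * x 0 ^ (2 * N) + fermatSign (s 1) * x 1 ^ (2 * N) +
    fermatSign (s 2))

theorem analyticAt_lastPow (N : ℕ) (s : Equiv.Perm (Fin 4)) (x : Fin 2 → ℂ) :
    AnalyticAt ℂ (lastPow N s) x :=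
  analyticAt_const.mul (((analyticAt_const.mul ((analyticAt_coord 0 x).pow _)).add
    (analyticAt_const.mul ((analyticAt_coord 1 x).pow _))).add analyticAt_const)

theorem sum_perm (s : Equiv.Perm (Fin 4)) (f : Fin 4 → ℂ) :
    ∑ r, f r = f (s 0) + f (s 1) + f (s 2) + f (s 3) := by
  rw [← Equiv.sum_comp s, Fin.sum_univ_four]

theorem chartVec_mem_iff {N : ℕ} (s : Equiv.Perm (Fin 4)) (x : Fin 2 → ℂ) (ζ : ℂ) :
    Projectivization.mk ℂ _ (chartVec_ne_zero s x ζ) ∈ projZeros (fermatEq N) ↔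
      ζ ^ (2 * N) = lastPow N s x := by
  rw [mk_mem_projZeros_fermatEq, sum_perm s]
  simp only [chartVec_apply, lastPow, Matrix.cons_val, one_pow, mul_one]
  have h := fermatSign_mul_self (s 3)
  constructor <;> intro e
  · linear_combination fermatSign (s 3) * e - ζ ^ (2 * N) * h
  · linear_combination fermatSign (s 3) * e - (fermatSign (s 0) * x 0 ^ (2 * N) +
      fermatSign (s 1) * x 1 ^ (2 * N) + fermatSign (s 2)) * h

/-- The affine coordinates of a point of projective space. -/
def affineCoords (s : Equiv.Perm (Fin 4)) (p : ℙ ℂ (Fin 4 → ℂ)) : Fin 2 → ℂ :=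
  ![coordRatio (s 0) (s 2) p, coordRatio (s 1) (s 2) p]

theorem affineCoords_chartVec (s : Equiv.Perm (Fin 4)) (x : Fin 2 → ℂ) (ζ : ℂ) :
    affineCoords s (Projectivization.mk ℂ _ (chartVec_ne_zero s x ζ)) = x := by
  ext i
  fin_cases i <;> simp [affineCoords, chartVec_apply]

theorem mk_chartVec_affineCoords (s : Equiv.Perm (Fin 4)) {p : ℙ ℂ (Fin 4 → ℂ)}
    (hp : p.rep (s 2) ≠ 0) :
    Projectivization.mk ℂ _
      (chartVec_ne_zero s (affineCoords s p) (coordRatio (s 3) (s 2) p)) = p := by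
  conv_rhs => rw [← p.mk_rep]
  rw [Projectivization.mk_eq_mk_iff']
  refine ⟨(p.rep (s 2))⁻¹, ?_⟩
  ext r
  obtain ⟨k, rfl⟩ := s.surjective r
  rw [chartVec_apply]
  fin_cases k <;> simp [affineCoords, coordRatio, hp, div_eq_inv_mul]

theorem coordRatio_pow_eq_lastPow {N : ℕ} (s : Equiv.Perm (Fin 4)) (p : Fermat N)
    (hp : p.1.rep (s 2) ≠ 0) :
    coordRatio (s 3) (s 2) p.1 ^ (2 * N) = lastPow N s (affineCoords s p.1) := by
  rw [← chartVec_mem_iff, mk_chartVec_affineCoords s hp]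
  exact p.2

/-- With the coordinate at `s 2` scaled to `1`, the one at `s 3` is a branch `ρ` of the `2N`-th root
of `lastPow`. The explicit form matters: `lastPow` sees only `2N`-th powers of `x`, so multiplying
`x` by `N`-th roots of unity leaves the last coordinate unchanged. -/
theorem exists_localParam {N : ℕ} (hN : N ≠ 0) (s : Equiv.Perm (Fin 4)) (p : Fermat N)
    (h2 : p.1.rep (s 2) ≠ 0) (h3 : p.1.rep (s 3) ≠ 0) :
    ∃ (e : OpenPartialHomeomorph (Fin 2 → ℂ) (Fermat N)) (ρ : ℂ → ℂ), IsLocalParam e ∧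
      p ∈ e.target ∧ e.symm p = affineCoords s p.1 ∧
      ∀ x ∈ e.source, (e x).1 =
        Projectivization.mk ℂ _ (chartVec_ne_zero s x (ρ (lastPow N s x))) := by
  classical
  have hN2 : 2 * N ≠ 0 := by lia
  obtain ⟨P, hP, hPpow, hPa⟩ := exists_root_branch hN2 (a := coordRatio (s 3) (s 2) p.1)
    (div_ne_zero h3 h2)
  have hmem : ∀ x, lastPow N s x ∈ P.target →
      Projectivization.mk ℂ _ (chartVec_ne_zero s x (P.symm (lastPow N s x))) ∈
        projZeros (fermatEq N) := by
    intro x hx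
    rw [chartVec_mem_iff, ← hPpow, P.right_inv hx]
  let S : Set (Fin 2 → ℂ) := {x | lastPow N s x ∈ P.target}
  let T : Set (Fermat N) := {q | q.1.rep (s 2) ≠ 0 ∧ coordRatio (s 3) (s 2) q.1 ∈ P.source}
  -- Off `S` the value `p` is arbitrary.
  let ψ : (Fin 2 → ℂ) → Fermat N := fun x => if h : lastPow N s x ∈ P.target then ⟨_, hmem x h⟩ else p
  have hψ : ∀ x ∈ S, (ψ x).1 =
      Projectivization.mk ℂ _ (chartVec_ne_zero s x (P.symm (lastPow N s x))) := by
    intro x hx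
    simp only [ψ, dif_pos (show lastPow N s x ∈ P.target from hx)]
  have hvec : ∀ x ∈ S,
      AnalyticAt ℂ (fun x => chartVec s x (P.symm (lastPow N s x))) x := by
    intro x hx
    rw [analyticAt_pi_iff]
    intro r
    obtain ⟨k, rfl⟩ := s.surjective r
    simp only [chartVec_apply]
    fin_cases k
    · exact analyticAt_coord 0 x
    · exact analyticAt_coord 1 x
    · exact analyticAt_const
    · exact AnalyticAt.comp (g := P.symm) (hPa _ hx) (analyticAt_lastPow N s x)
  have hS : IsOpen S := P.open_target.preimage
    (continuous_iff_continuousAt.2 fun x => (analyticAt_lastPow N s x).continuousAt)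
  have hU : IsOpen {q : Fermat N | q.1.rep (s 2) ≠ 0} :=
    (isOpen_rep_apply_ne_zero (s 2)).preimage continuous_subtype_val
  have hratio : ∀ k, ContinuousOn (fun q : Fermat N => coordRatio (s k) (s 2) q.1)
      {q : Fermat N | q.1.rep (s 2) ≠ 0} := fun k =>
    (continuousOn_coordRatio (s k) (s 2)).comp continuous_subtype_val.continuousOn fun q hq => hq
  have hT : IsOpen T := (hratio 3).isOpen_inter_preimage hU P.open_source
  have hST : ∀ x ∈ S, ψ x ∈ T := by
    intro x hx
    refine ⟨?_, ?_⟩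
    · rw [hψ x hx, ne_eq, mk_rep_apply_eq_zero_iff, chartVec_apply]
      simp
    · rw [hψ x hx, coordRatio_mk, chartVec_apply, chartVec_apply]
      simpa using P.map_target hx
  have hpow : ∀ q ∈ T, lastPow N s (affineCoords s q.1) = P (coordRatio (s 3) (s 2) q.1) := by
    intro q hq
    rw [hPpow, coordRatio_pow_eq_lastPow s q hq.1]
  have hTS : ∀ q ∈ T, affineCoords s q.1 ∈ S := by
    intro q hq
    change lastPow N s (affineCoords s q.1) ∈ P.target
    rw [hpow q hq]
    exact P.map_source hq.2
  have hright : ∀ q ∈ T, ψ (affineCoords s q.1) = q := by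
    intro q hq
    refine Subtype.ext ?_
    rw [hψ _ (hTS q hq)]
    simp only [hpow q hq, P.left_inv hq.2]
    exact mk_chartVec_affineCoords s hq.1
  have hψc : ContinuousOn ψ S := by
    rw [Topology.IsInducing.subtypeVal.continuousOn_iff]
    have hc : ContinuousOn (fun x => chartVec s x (P.symm (lastPow N s x))) S := fun x hx =>
      (hvec x hx).continuousAt.continuousWithinAt
    have hc' : ContinuousOn (fun x => (⟨_, chartVec_ne_zero s x (P.symm (lastPow N s x))⟩ :
        {v : Fin 4 → ℂ // v ≠ 0})) S :=
      Topology.IsInducing.subtypeVal.continuousOn_iff.2 hc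
    exact (continuous_projMk.comp_continuousOn hc').congr fun x hx => hψ x hx
  have hinvc : ContinuousOn (fun q : Fermat N => affineCoords s q.1) T := by
    refine continuousOn_pi.2 fun k => ?_
    fin_cases k
    · exact (hratio 0).mono fun q hq => hq.1
    · exact (hratio 1).mono fun q hq => hq.1
  let e : OpenPartialHomeomorph (Fin 2 → ℂ) (Fermat N) :=
    { toFun := ψ
      invFun := fun q => affineCoords s q.1
      source := S
      target := T
      map_source' := hST
      map_target' := hTS
      left_inv' := fun x hx => by rw [hψ x hx, affineCoords_chartVec]
      right_inv' := hright
      open_source := hS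
      open_target := hT
      continuousOn_toFun := hψc
      continuousOn_invFun := hinvc }
  refine ⟨e, P.symm, ?_, ⟨h2, hP⟩, rfl, hψ⟩
  intro x hx f
  change HolSpace.holAt f (ψ x) ↔ AnalyticAt ℂ (fun z => f (ψ z)) x
  constructor
  · intro hf
    obtain ⟨g, hg, hgf⟩ := hf _ (chartVec_ne_zero s x _) (hψ x hx).symm
    refine (AnalyticAt.comp (g := g) (f := fun x => chartVec s x (P.symm (lastPow N s x)))
      hg (hvec x hx)).congr ?_
    filter_upwards [(hvec x hx).continuousAt.eventually hgf, hS.mem_nhds hx] with y hy hyS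
    rw [Function.comp_apply, ← hy (chartVec_ne_zero s y _) (hmem y hyS)]
    exact congrArg f (Subtype.ext (hψ y hyS).symm)
  -- The affine coordinates are ratios, analytic on the cone where the coordinate at `s 2` is
  -- nonzero. Composing `f ∘ ψ` with them gives the required ambient function near `v`.
  · intro hf v hv hvx
    have hxT := hST x hx
    have hvl : v (s 2) ≠ 0 := by
      have := hxT.1
      rwa [← hvx, ne_eq, mk_rep_apply_eq_zero_iff] at this
    have hcoord : AnalyticAt ℂ (fun w : Fin 4 → ℂ => ![w (s 0) / w (s 2), w (s 1) / w (s 2)]) v := by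
      rw [analyticAt_pi_iff]
      intro k
      fin_cases k
      · exact (analyticAt_coord (s 0) v).div (analyticAt_coord (s 2) v) hvl
      · exact (analyticAt_coord (s 1) v).div (analyticAt_coord (s 2) v) hvl
    have hvec_eq : ∀ (w : Fin 4 → ℂ) (hw : w ≠ 0),
        affineCoords s (Projectivization.mk ℂ w hw) = ![w (s 0) / w (s 2), w (s 1) / w (s 2)] := by
      intro w hw
      simp [affineCoords]
    have hvx' : ![v (s 0) / v (s 2), v (s 1) / v (s 2)] = x := by
      rw [← hvec_eq v hv, hvx, hψ x hx, affineCoords_chartVec]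
    refine ⟨fun w => f (ψ ![w (s 0) / w (s 2), w (s 1) / w (s 2)]),
      AnalyticAt.comp (g := fun z => f (ψ z)) (by rw [hvx']; exact hf) hcoord, ?_⟩
    obtain ⟨O, hO, hOT⟩ := isOpen_induced_iff.1 hT
    have hvO : Projectivization.mk ℂ v hv ∈ O := by
      rw [hvx]
      have : ψ x ∈ Subtype.val ⁻¹' O := by rw [hOT]; exact hxT
      exact this
    filter_upwards [eventually_mk_mem hO hv hvO] with w hw hw0 hwZ
    have hwT : (⟨Projectivization.mk ℂ w hw0, hwZ⟩ : Fermat N) ∈ T := by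
      rw [← hOT]
      exact hw hw0
    rw [← hvec_eq w hw0, hright _ hwT]

/-! ### The singular points of the degenerate fibres -/

theorem minor_eq_zero_of_rank_lt_two {m n : ℕ} {A : Matrix (Fin m) (Fin n) ℂ} (h : A.rank < 2)
    (r r' : Fin m) (s s' : Fin n) : A r s * A r' s' = A r s' * A r' s := by
  by_contra hne
  have hdet : IsUnit (A.submatrix ![r, r'] ![s, s']) := by
    rw [Matrix.isUnit_iff_isUnit_det, isUnit_iff_ne_zero, Matrix.det_fin_two]
    simpa [sub_eq_zero] using hne
  have h₁ := Matrix.rank_of_isUnit _ hdet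
  have h₂ := Matrix.rank_submatrix_le A ![r, r'] ![s, s']
  rw [Fintype.card_fin] at h₁
  lia

/-- The coefficients of the equations of the rapidity curve. -/
def rapidityMatrix (κ : Param) : Matrix (Fin 4) (Fin 4) ℂ :=
  !![κ.k, 0, κ.k', -κ.k₀; 0, κ.k, -κ.k₀, κ.k'; κ.k₀, κ.k', 0, -κ.k; κ.k', κ.k₀, -κ.k, 0]

theorem eval_rapidityEqs (N : ℕ) (κ : Param) (v : Fin 4 → ℂ) (r : Fin 4) :
    MvPolynomial.eval v (rapidityEqs N κ r) = ∑ j, rapidityMatrix κ r j * v j ^ N := by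
  rw [Fin.sum_univ_four]
  fin_cases r <;> simp [rapidityEqs, rapidityMatrix] <;> ring

theorem jacobian_rapidityEqs (N : ℕ) (κ : Param) (v : Fin 4 → ℂ) (r j : Fin 4) :
    jacobian (rapidityEqs N κ) v r j = rapidityMatrix κ r j * (N * v j ^ (N - 1)) := by
  fin_cases r <;> fin_cases j <;>
    simp [jacobian, rapidityEqs, rapidityMatrix, MvPolynomial.pderiv_X, Derivation.leibniz_pow]

theorem natCast_mul_pow_eq_zero_iff {N : ℕ} (hN : 2 ≤ N) (z : ℂ) :
    (N : ℂ) * z ^ (N - 1) = 0 ↔ z = 0 := by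
  have h₀ : (N : ℂ) ≠ 0 := by
    exact_mod_cast (show N ≠ 0 by lia)
  rw [mul_eq_zero, pow_eq_zero_iff (by lia)]
  simp [h₀]

/-- Two equations in disjoint pairs of coordinates: at a singular point one of the pairs
vanishes. -/
theorem pair_eq_zero_of_mem_projSing {N : ℕ} (hN : 2 ≤ N) {κ : Param} {p : ℙ ℂ (Fin 4 → ℂ)}
    (hp : p ∈ projSing 2 (rapidityEqs N κ)) (r r' a b c d : Fin 4)
    (ha : rapidityMatrix κ r a ≠ 0) (hb : rapidityMatrix κ r b ≠ 0)
    (hc : rapidityMatrix κ r' c ≠ 0) (hd : rapidityMatrix κ r' d ≠ 0)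
    (ha' : rapidityMatrix κ r' a = 0) (hb' : rapidityMatrix κ r' b = 0) :
    (p.rep a = 0 ∧ p.rep b = 0) ∨ (p.rep c = 0 ∧ p.rep d = 0) := by
  -- As row `r'` vanishes at `x`, the minor in columns `x, y` reduces to a single product, whose
  -- coefficients from the matrix are nonzero.
  have key : ∀ x y : Fin 4, rapidityMatrix κ r x ≠ 0 → rapidityMatrix κ r' y ≠ 0 →
      rapidityMatrix κ r' x = 0 → p.rep x = 0 ∨ p.rep y = 0 := by
    intro x y hx hy hx'
    have h := minor_eq_zero_of_rank_lt_two hp.2 r r' x y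
    simp only [jacobian_rapidityEqs, hx', zero_mul, mul_zero, mul_eq_zero, hx, hy, false_or] at h
    simpa only [← mul_eq_zero, natCast_mul_pow_eq_zero_iff hN] using h
  have h₁ := key a c ha hc ha'
  have h₂ := key a d ha hd ha'
  have h₃ := key b c hb hc hb'
  have h₄ := key b d hb hd hb'
  tauto

/-- Columns of the Jacobian other than `l` and `m` carry a factor `0 ^ (N - 1)`, which is zero as `N
≥ 2`; the other two are proportional. So the Jacobian is an outer product, of rank at most one. -/
theorem mem_projSing_of_columns {N : ℕ} (hN : 2 ≤ N) {κ : Param} {p : ℙ ℂ (Fin 4 → ℂ)}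
    (l m : Fin 4) (hlm : l ≠ m) (h0 : ∀ j, j ≠ l → j ≠ m → p.rep j = 0) (c : ℂ)
    (hcol : ∀ r, rapidityMatrix κ r m = c * rapidityMatrix κ r l)
    (hrel : p.rep l ^ N + c * p.rep m ^ N = 0) : p ∈ projSing 2 (rapidityEqs N κ) := by
  have hN0 : N ≠ 0 := by lia
  refine ⟨fun r => ?_, ?_⟩
  · rw [eval_rapidityEqs, ← Finset.sum_subset (Finset.subset_univ {l, m}), Finset.sum_pair hlm, hcol]
    · linear_combination rapidityMatrix κ r l * hrel
    · intro j _ hj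
      simp only [Finset.mem_insert, Finset.mem_singleton, not_or] at hj
      rw [h0 j hj.1 hj.2, zero_pow hN0, mul_zero]
  · have : jacobian (rapidityEqs N κ) p.rep = Matrix.vecMulVec (fun r => rapidityMatrix κ r l)
        fun j => (if j = m then c else 1) * (N * p.rep j ^ (N - 1)) := by
      ext r j
      rw [jacobian_rapidityEqs, Matrix.vecMulVec_apply]
      by_cases hm : j = m
      · subst hm
        rw [if_pos rfl, hcol]
        ring
      · by_cases hl : j = l
        · subst hl
          rw [if_neg hm, one_mul]
        · rw [h0 j hl hm, zero_pow (by lia)]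
          simp
    rw [this]
    exact (Matrix.rank_vecMulVec_le _ _).trans_lt one_lt_two

/-- The pair of coordinates `i, j` vanishes at the image of a singular point over `0` or `∞`. -/
def IsScalarPair (i j : Fin 4) : Prop :=
  (i = 0 ∧ j = 2) ∨ (i = 0 ∧ j = 3) ∨ (i = 1 ∧ j = 2) ∨ (i = 1 ∧ j = 3)

/-- The pair of coordinates `i, j` vanishes at the image of a singular point over `±1`. -/
def IsTypeAPair (i j : Fin 4) : Prop := (i = 0 ∧ j = 1) ∨ (i = 2 ∧ j = 3)

theorem exists_scalarPair {N : ℕ} (hN : 2 ≤ N) {κ : Param} (hκ : κ.ZeroOrInfty) {p : Fermat N}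
    (hp : p ∈ fibreSing N κ) :
    ∃ i j, IsScalarPair i j ∧ p.1.rep i = 0 ∧ p.1.rep j = 0 := by
  have hc := κ.conic
  have hne := κ.ne_zero
  rcases hκ with h | h
  · have hk : κ.k ≠ 0 := by
      intro h'
      rw [h, h'] at hc
      exact hne (by simpa [h, h'] using hc.symm)
    have hk₀ : κ.k₀ ≠ 0 := by
      intro h'
      rw [h, h'] at hc
      exact hk (by simpa using hc)
    rcases pair_eq_zero_of_mem_projSing hN hp 0 1 0 3 1 2 (by simpa [rapidityMatrix])
      (by simpa [rapidityMatrix]) (by simpa [rapidityMatrix]) (by simpa [rapidityMatrix])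
      (by simp [rapidityMatrix]) (by simpa [rapidityMatrix]) with h' | h'
    · exact ⟨0, 3, by simp [IsScalarPair], h'⟩
    · exact ⟨1, 2, by simp [IsScalarPair], h'⟩
  · have hk : κ.k ≠ 0 := by
      intro h'
      rw [h, h'] at hc
      exact hne (by simpa [h, h'] using hc)
    have hk' : κ.k' ≠ 0 := by
      intro h'
      rw [h, h'] at hc
      exact hk (by simpa using hc)
    rcases pair_eq_zero_of_mem_projSing hN hp 0 1 0 2 1 3 (by simpa [rapidityMatrix])
      (by simpa [rapidityMatrix]) (by simpa [rapidityMatrix]) (by simpa [rapidityMatrix])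
      (by simp [rapidityMatrix]) (by simpa [rapidityMatrix]) with h' | h'
    · exact ⟨0, 2, by simp [IsScalarPair], h'⟩
    · exact ⟨1, 3, by simp [IsScalarPair], h'⟩

theorem exists_typeAPair {N : ℕ} (hN : 2 ≤ N) {κ : Param} (hκ : κ.PlusMinusOne) {p : Fermat N}
    (hp : p ∈ fibreSing N κ) :
    ∃ i j, IsTypeAPair i j ∧ p.1.rep i = 0 ∧ p.1.rep j = 0 := by
  have hc := κ.conic
  have hne := κ.ne_zero
  have hsq : κ.k' ^ 2 = κ.k₀ ^ 2 := sq_eq_sq_iff_eq_or_eq_neg.2 hκ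
  have hk : κ.k = 0 := by
    rw [hsq] at hc
    simpa using hc
  have hk₀ : κ.k₀ ≠ 0 := by
    intro h'
    rw [h'] at hsq
    exact hne (by simpa [h', hk] using hsq)
  have hk' : κ.k' ≠ 0 := by
    intro h'
    rw [h'] at hsq
    exact hk₀ (by simpa using hsq.symm)
  rcases pair_eq_zero_of_mem_projSing hN hp 0 2 2 3 0 1 (by simpa [rapidityMatrix])
    (by simpa [rapidityMatrix]) (by simpa [rapidityMatrix]) (by simpa [rapidityMatrix])
    (by simp [rapidityMatrix]) (by simpa [rapidityMatrix]) with h' | h'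
  · exact ⟨2, 3, by simp [IsTypeAPair], h'⟩
  · exact ⟨0, 1, by simp [IsTypeAPair], h'⟩

/-! ### From vanishing pairs of coordinates back to degenerate parameters -/

theorem sum_fermatSign_rep_sq {N : ℕ} (p : Fermat N) :
    (p.1.rep 0 ^ N) ^ 2 + (p.1.rep 2 ^ N) ^ 2 = (p.1.rep 1 ^ N) ^ 2 + (p.1.rep 3 ^ N) ^ 2 := by
  have h := sum_fermatSign_rep p
  simp only [Fin.sum_univ_four, fermatSign, Matrix.cons_val, mul_comm 2 N, pow_mul] at h
  linear_combination h

/-- A third zero would make the Fermat equation kill the fourth coordinate as well. -/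
theorem rep_ne_zero_of_pair {N : ℕ} (hN : N ≠ 0) (p : Fermat N) {i j : Fin 4} (hij : i ≠ j)
    (hi : p.1.rep i = 0) (hj : p.1.rep j = 0) (l : Fin 4) (hli : l ≠ i) (hlj : l ≠ j) :
    p.1.rep l ≠ 0 := by
  intro hl
  have h := sum_fermatSign_rep p
  have fourth : ∀ i j l : Fin 4, i ≠ j → l ≠ i → l ≠ j →
      ∃ m, ∀ r, r = i ∨ r = j ∨ r = l ∨ r = m := by decide
  obtain ⟨m, hm⟩ := fourth i j l hij hli hlj
  have hz : ∀ r, r ≠ m → p.1.rep r = 0 := by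
    intro r hr
    rcases hm r with rfl | rfl | rfl | rfl
    exacts [hi, hj, hl, absurd rfl hr]
  rw [Finset.sum_eq_single m (fun r _ hr => by rw [hz r hr, zero_pow (by lia), mul_zero])
    (by simp)] at h
  have hs : fermatSign m ≠ 0 := left_ne_zero_of_mul_eq_one (fermatSign_mul_self m)
  have hm0 : p.1.rep m = 0 := by
    simpa [hs, hN] using h
  refine p.1.rep_nonzero (funext fun r => ?_)
  by_cases hr : r = m
  · rw [hr, hm0]; rfl
  · exact hz r hr

/-- The parameter is obtained by solving one fibre equation in the two surviving coordinates: its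
entries are, up to sign, their `N`-th powers. The Fermat equation then becomes the equation of the
conic, and also the proportionality of the two columns. -/
theorem exists_zeroOrInfty {N : ℕ} (hN : 2 ≤ N) {p : Fermat N} {i j : Fin 4}
    (hij : IsScalarPair i j) (hi : p.1.rep i = 0) (hj : p.1.rep j = 0) :
    ∃ κ : Param, κ.ZeroOrInfty ∧ p ∈ fibreSing N κ := by
  have hN0 : N ≠ 0 := by lia
  have hsq := sum_fermatSign_rep_sq p
  rcases hij with ⟨rfl, rfl⟩ | ⟨rfl, rfl⟩ | ⟨rfl, rfl⟩ | ⟨rfl, rfl⟩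
  · have h1 := pow_ne_zero N (rep_ne_zero_of_pair hN0 p (by decide) hi hj 1 (by decide) (by decide))
    have h3 := pow_ne_zero N (rep_ne_zero_of_pair hN0 p (by decide) hi hj 3 (by decide) (by decide))
    rw [hi, hj, zero_pow hN0] at hsq
    refine ⟨⟨p.1.rep 1 ^ N, -p.1.rep 3 ^ N, 0, by simp [h1], by linear_combination -hsq⟩,
      Or.inr rfl, mem_projSing_of_columns hN 1 3 (by decide) ?_ (-p.1.rep 1 ^ N / p.1.rep 3 ^ N)
      ?_ ?_⟩
    · intro r
      fin_cases r <;> simp [hi, hj]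
    · intro r
      fin_cases r <;> simp [rapidityMatrix] <;> field_simp
      linear_combination -hsq
    · field_simp
      ring
  · have h1 := pow_ne_zero N (rep_ne_zero_of_pair hN0 p (by decide) hi hj 1 (by decide) (by decide))
    have h2 := pow_ne_zero N (rep_ne_zero_of_pair hN0 p (by decide) hi hj 2 (by decide) (by decide))
    rw [hi, hj, zero_pow hN0] at hsq
    refine ⟨⟨0, p.1.rep 2 ^ N, p.1.rep 1 ^ N, by simp [h1], by linear_combination hsq⟩,
      Or.inl rfl, mem_projSing_of_columns hN 1 2 (by decide) ?_ (-p.1.rep 1 ^ N / p.1.rep 2 ^ N)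
      ?_ ?_⟩
    · intro r
      fin_cases r <;> simp [hi, hj]
    · intro r
      fin_cases r <;> simp [rapidityMatrix] <;> field_simp
      linear_combination -hsq
    · field_simp
      ring
  · have h0 := pow_ne_zero N (rep_ne_zero_of_pair hN0 p (by decide) hi hj 0 (by decide) (by decide))
    have h3 := pow_ne_zero N (rep_ne_zero_of_pair hN0 p (by decide) hi hj 3 (by decide) (by decide))
    rw [hi, hj, zero_pow hN0] at hsq
    refine ⟨⟨0, p.1.rep 3 ^ N, p.1.rep 0 ^ N, by simp [h0], by linear_combination -hsq⟩,
      Or.inl rfl, mem_projSing_of_columns hN 0 3 (by decide) ?_ (-p.1.rep 0 ^ N / p.1.rep 3 ^ N)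
      ?_ ?_⟩
    · intro r
      fin_cases r <;> simp [hi, hj]
    · intro r
      fin_cases r <;> simp [rapidityMatrix] <;> field_simp
      linear_combination hsq
    · field_simp
      ring
  · have h0 := pow_ne_zero N (rep_ne_zero_of_pair hN0 p (by decide) hi hj 0 (by decide) (by decide))
    have h2 := pow_ne_zero N (rep_ne_zero_of_pair hN0 p (by decide) hi hj 2 (by decide) (by decide))
    rw [hi, hj, zero_pow hN0] at hsq
    refine ⟨⟨p.1.rep 0 ^ N, -p.1.rep 2 ^ N, 0, by simp [h0], by linear_combination hsq⟩,
      Or.inr rfl, mem_projSing_of_columns hN 0 2 (by decide) ?_ (-p.1.rep 0 ^ N / p.1.rep 2 ^ N)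
      ?_ ?_⟩
    · intro r
      fin_cases r <;> simp [hi, hj]
    · intro r
      fin_cases r <;> simp [rapidityMatrix] <;> field_simp
      linear_combination hsq
    · field_simp
      ring

theorem exists_plusMinusOne {N : ℕ} (hN : 2 ≤ N) {p : Fermat N} {i j : Fin 4}
    (hij : IsTypeAPair i j) (hi : p.1.rep i = 0) (hj : p.1.rep j = 0) :
    ∃ κ : Param, κ.PlusMinusOne ∧ p ∈ fibreSing N κ := by
  have hN0 : N ≠ 0 := by lia
  have hsq := sum_fermatSign_rep_sq p
  rcases hij with ⟨rfl, rfl⟩ | ⟨rfl, rfl⟩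
  · have h2 := pow_ne_zero N (rep_ne_zero_of_pair hN0 p (by decide) hi hj 2 (by decide) (by decide))
    have h3 := pow_ne_zero N (rep_ne_zero_of_pair hN0 p (by decide) hi hj 3 (by decide) (by decide))
    rw [hi, hj, zero_pow hN0] at hsq
    refine ⟨⟨p.1.rep 3 ^ N, 0, p.1.rep 2 ^ N, by simp [h2], by linear_combination -hsq⟩,
      sq_eq_sq_iff_eq_or_eq_neg.1 (by linear_combination -hsq),
      mem_projSing_of_columns hN 2 3 (by decide) ?_ (-p.1.rep 2 ^ N / p.1.rep 3 ^ N) ?_ ?_⟩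
    · intro r
      fin_cases r <;> simp [hi, hj]
    · intro r
      fin_cases r <;> simp [rapidityMatrix] <;> field_simp
      linear_combination -hsq
    · field_simp
      ring
  · have h0 := pow_ne_zero N (rep_ne_zero_of_pair hN0 p (by decide) hi hj 0 (by decide) (by decide))
    have h1 := pow_ne_zero N (rep_ne_zero_of_pair hN0 p (by decide) hi hj 1 (by decide) (by decide))
    rw [hi, hj, zero_pow hN0] at hsq
    refine ⟨⟨-p.1.rep 0 ^ N, 0, p.1.rep 1 ^ N, by simp [h1], by linear_combination hsq⟩,
      sq_eq_sq_iff_eq_or_eq_neg.1 (by linear_combination hsq),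
      mem_projSing_of_columns hN 0 1 (by decide) ?_ (-p.1.rep 0 ^ N / p.1.rep 1 ^ N) ?_ ?_⟩
    · intro r
      fin_cases r <;> simp [hi, hj]
    · intro r
      fin_cases r <;> simp [rapidityMatrix] <;> field_simp
      linear_combination -hsq
    · field_simp
      ring

/-! ### Orbifold charts of the quotient surface -/

theorem diag_zpow {n : ℕ} (t : Fin n → ℂˣ) (k : ℤ) : diag t ^ k = diag (t ^ k) := by
  let φ : (Fin n → ℂˣ) →* GLin n := ⟨⟨diag, diag_one⟩, diag_mul⟩
  exact (map_zpow φ t k).symm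

theorem diag_pair_zpow_apply (u v : ℂˣ) (k : ℤ) (x : Fin 2 → ℂ) :
    (diag ![u, v] ^ k) x = ![((u ^ k : ℂˣ) : ℂ) * x 0, ((v ^ k : ℂˣ) : ℂ) * x 1] := by
  rw [diag_zpow]
  ext i
  fin_cases i <;> rfl

theorem norm_eq_one_of_pow_eq_one {N : ℕ} (hN : N ≠ 0) {u : ℂˣ} (hu : u ^ N = 1) :
    ‖(u : ℂ)‖ = 1 :=
  Complex.norm_eq_one_of_pow_eq_one (n := N)
    (by rw [← Units.val_pow_eq_pow_val, hu, Units.val_one]) hN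

theorem norm_apply_of_mem_zpowers {N : ℕ} (hN : N ≠ 0) {u v : ℂˣ} (hu : u ^ N = 1)
    (hv : v ^ N = 1) : ∀ g ∈ Subgroup.zpowers (diag ![u, v]), ∀ x : Fin 2 → ℂ, ‖g x‖ = ‖x‖ := by
  refine invariant_of_mem_zpowers (F := fun x : Fin 2 → ℂ => ‖x‖) fun x => ?_
  have h : ∀ i, ‖diag ![u, v] x i‖₊ = ‖x i‖₊ := by
    intro i
    ext
    fin_cases i <;>
      simp [norm_eq_one_of_pow_eq_one hN hu, norm_eq_one_of_pow_eq_one hN hv]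
  change ‖diag ![u, v] x‖ = ‖x‖
  simp only [Pi.norm_def, h]

theorem finite_zpowers_diag {N : ℕ} (hN : N ≠ 0) {u v : ℂˣ} (hu : u ^ N = 1) (hv : v ^ N = 1) :
    Finite (Subgroup.zpowers (diag ![u, v])) := by
  refine (finite_zpowers.2 (isOfFinOrder_iff_pow_eq_one.2 ?_)).to_subtype
  refine ⟨N, Nat.pos_of_ne_zero hN, ?_⟩
  rw [← zpow_natCast, diag_zpow]
  have : (![u, v] ^ (N : ℤ)) = 1 := by
    ext i
    fin_cases i <;> simp [hu, hv]
  rw [this, diag_one]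

theorem isConnected_ball {n : ℕ} (x : Fin n → ℂ) {r : ℝ} (hr : 0 < r) :
    IsConnected (Metric.ball x r) :=
  ⟨⟨x, Metric.mem_ball_self hr⟩, (convex_ball x r).isPreconnected⟩

theorem eq_of_diag_smul_eq {t : Fin 4 → ℂˣ} {p : ℙ ℂ (Fin 4 → ℂ)} :
    diag t • p = p → ∀ a b, p.rep a ≠ 0 → p.rep b ≠ 0 → t a = t b := by
  intro h a b ha hb
  have h' : diag t • Projectivization.mk ℂ p.rep p.rep_nonzero =
      Projectivization.mk ℂ p.rep p.rep_nonzero := by rwa [p.mk_rep]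
  rw [Projectivization.smul_mk, mk_eq_mk_iff_minors] at h'
  have := h' a b
  change (t a : ℂ) * p.rep a * p.rep b = t b * p.rep b * p.rep a at this
  refine Units.ext (mul_right_cancel₀ (mul_ne_zero ha hb) ?_)
  linear_combination this

/-- Dividing by `t (s 2)` restores the coordinate normalized to `1`; this is how the torus acts
linearly in a chart. -/
theorem smul_coord_of_diag_smul_chartVec {s : Equiv.Perm (Fin 4)} {t : Fin 4 → ℂˣ}
    {x y : Fin 2 → ℂ} {ζ ξ : ℂ}
    (h : diag t • Projectivization.mk ℂ _ (chartVec_ne_zero s x ζ) =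
      Projectivization.mk ℂ _ (chartVec_ne_zero s y ξ)) :
    y = ![((t (s 0) / t (s 2) : ℂˣ) : ℂ) * x 0, ((t (s 1) / t (s 2) : ℂˣ) : ℂ) * x 1] := by
  have h' := congrArg (affineCoords s) h
  rw [affineCoords_chartVec] at h'
  rw [← h', Projectivization.smul_mk]
  ext i
  have e : ∀ k, (diag t • chartVec s x ζ) (s k) = t (s k) * ![x 0, x 1, 1, ζ] k := by
    intro k
    rw [← chartVec_apply]
    rfl
  fin_cases i <;> simp only [affineCoords, coordRatio_mk, e] <;> simp [mul_div_right_comm]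

theorem exists_torusAut_eq {N : ℕ} (hN : N ≠ 0) (h : H N) :
    ∃ t : torus N, ∀ p, h • p = torusAut N t p := by
  obtain ⟨h, hh⟩ := h
  rw [H_eq_range hN] at hh
  obtain ⟨t, rfl⟩ := hh
  exact ⟨t, fun _ => rfl⟩

/-- A local parametrization centred at a point, together with a ball on which points with the same
orbit are related by the stabilizer. -/
theorem exists_adapted_localParam {N : ℕ} (hN : N ≠ 0) (s : Equiv.Perm (Fin 4)) (p : Fermat N)
    (h2 : p.1.rep (s 2) ≠ 0) (h3 : p.1.rep (s 3) ≠ 0) :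
    ∃ (e : OpenPartialHomeomorph (Fin 2 → ℂ) (Fermat N)) (ρ : ℂ → ℂ) (r : ℝ),
      IsLocalParam e ∧ 0 < r ∧ Metric.ball (affineCoords s p.1) r ⊆ e.source ∧
      e (affineCoords s p.1) = p ∧
      (∀ x ∈ e.source, (e x).1 =
        Projectivization.mk ℂ _ (chartVec_ne_zero s x (ρ (lastPow N s x)))) ∧
      ∀ x ∈ Metric.ball (affineCoords s p.1) r, ∀ y ∈ Metric.ball (affineCoords s p.1) r,
        ∀ h : H N, h • e x = e y → h • p = p := by
  have := finite_H hN
  have := continuousConstSMul_H hN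
  obtain ⟨e, ρ, he, hpe, hsymm, hform⟩ := exists_localParam hN s p h2 h3
  obtain ⟨U, hU, hpU, hsep⟩ := exists_isOpen_smul_eq_of_mem (G := H N) p
  have hep : e (affineCoords s p.1) = p := by rw [← hsymm, e.right_inv hpe]
  have hmem : affineCoords s p.1 ∈ e.source := by rw [← hsymm]; exact e.map_target hpe
  have hopen : IsOpen (e.source ∩ e ⁻¹' U) := e.isOpen_inter_preimage hU
  obtain ⟨r, hr, hball⟩ := Metric.isOpen_iff.1 hopen _ ⟨hmem, by rwa [Set.mem_preimage, hep]⟩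
  refine ⟨e, ρ, r, he, hr, fun x hx => (hball hx).1, hep, hform, fun x hx y hy h hxy => ?_⟩
  exact hsep h (e x) (hball hx).2 (by rw [hxy]; exact (hball hy).2)

/-- The charts of the atlas: they come from local parametrizations of the Fermat surface. -/
def IsLiftedChart (N : ℕ) (c : OrbifoldChart 2 (WH N)) : Prop :=
  ∃ e : OpenPartialHomeomorph (Fin 2 → ℂ) (Fermat N), IsLocalParam e ∧ c.dom ⊆ e.source ∧
    ∀ x ∈ c.dom, c.toFun x = toWH N (e x)

/-- The hypotheses `hto` and `hof` say that the isotropy group of `p`, acting on the coordinates `i`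
and `j` with the other entries scaled to `1`, is generated by `diag(ω, u)`. This group preserves the
sup norm, hence the ball that serves as domain. -/
theorem exists_cyclic_chart {N : ℕ} (hN : N ≠ 0) (p : Fermat N) {i j : Fin 4} (hij : i ≠ j)
    (hi : p.1.rep i = 0) (hj : p.1.rep j = 0) {u : ℂˣ} (hu : u ^ N = 1)
    (hto : ∀ k : ℤ, ∃ t ∈ torus N, t i = omega N ^ k ∧ t j = u ^ k ∧ ∀ r, r ≠ i → r ≠ j → t r = 1)
    (hof : ∀ t ∈ torus N, ∀ τ, (∀ r, r ≠ i → r ≠ j → t r = τ) →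
      ∃ k : ℤ, t i / τ = omega N ^ k ∧ t j / τ = u ^ k) :
    ∃ c : OrbifoldChart 2 (WH N), IsLiftedChart N c ∧
      c.group = Subgroup.zpowers (diag ![omega N, u]) ∧ 0 ∈ c.dom ∧ c.toFun 0 = toWH N p := by
  have := continuousConstSMul_H hN
  have hω := omega_pow_eq_one hN
  have perm : ∀ i j : Fin 4, i ≠ j → ∃ s : Equiv.Perm (Fin 4), s 0 = i ∧ s 1 = j := by decide
  obtain ⟨s, rfl, rfl⟩ := perm i j hij
  have s20 : s 2 ≠ s 0 := s.injective.ne (by decide)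
  have s21 : s 2 ≠ s 1 := s.injective.ne (by decide)
  have s30 : s 3 ≠ s 0 := s.injective.ne (by decide)
  have s31 : s 3 ≠ s 1 := s.injective.ne (by decide)
  have h2 := rep_ne_zero_of_pair hN p hij hi hj (s 2) s20 s21
  have h3 := rep_ne_zero_of_pair hN p hij hi hj (s 3) s30 s31
  obtain ⟨e, ρ, r, he, hr, hball, hep, hform, hstab⟩ := exists_adapted_localParam hN s p h2 h3
  have hcoord : affineCoords s p.1 = 0 := by
    ext k
    fin_cases k <;> simp [affineCoords, coordRatio, hi, hj]
  rw [hcoord] at hball hep hstab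
  have hnorm := norm_apply_of_mem_zpowers hN hω hu
  have hinv : ∀ g ∈ Subgroup.zpowers (diag ![omega N, u]), ∀ x ∈ Metric.ball (0 : Fin 2 → ℂ) r,
      g x ∈ Metric.ball (0 : Fin 2 → ℂ) r := by
    intro g hg x hx
    rw [mem_ball_zero_iff] at hx ⊢
    rwa [hnorm g hg]
  have hfib : ∀ x ∈ Metric.ball (0 : Fin 2 → ℂ) r, ∀ y ∈ Metric.ball (0 : Fin 2 → ℂ) r,
      (∃ h : H N, h • e x = e y) ↔ ∃ k ∈ Subgroup.zpowers (diag ![omega N, u]), k x = y := by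
    intro x hx y hy
    constructor
    · rintro ⟨h, hxy⟩
      have hp := hstab x hx y hy h hxy
      obtain ⟨t, ht⟩ := exists_torusAut_eq hN h
      rw [ht] at hp hxy
      have hp' := congrArg Subtype.val hp
      have hxy' := congrArg Subtype.val hxy
      rw [torusAut_apply] at hp' hxy'
      rw [hform x (hball hx), hform y (hball hy)] at hxy'
      have hy' := smul_coord_of_diag_smul_chartVec hxy'
      have h23 := eq_of_diag_smul_eq hp' (s 3) (s 2) h3 h2
      obtain ⟨k, hk₀, hk₁⟩ := hof t.1 t.2 (t.1 (s 2)) (by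
        intro a ha0 ha1
        obtain ⟨b, rfl⟩ := s.surjective a
        fin_cases b
        exacts [absurd rfl ha0, absurd rfl ha1, rfl, h23])
      refine ⟨diag ![omega N, u] ^ k, ⟨k, rfl⟩, ?_⟩
      rw [diag_pair_zpow_apply, hy', hk₀, hk₁]
    · rintro ⟨_, ⟨k, rfl⟩, rfl⟩
      obtain ⟨t, ht, ht0, ht1, htr⟩ := hto k
      refine (exists_smul_iff hN _ _).2 ⟨⟨t, ht⟩, Subtype.ext ?_⟩
      rw [torusAut_apply, hform x (hball hx), hform _ (hball hy), Projectivization.smul_mk]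
      have hpow : ∀ {w : ℂˣ}, w ^ N = 1 → ((w ^ k : ℂˣ) : ℂ) ^ (2 * N) = 1 := by
        intro w hw
        rw [← Units.val_pow_eq_pow_val, ← zpow_natCast, zpow_comm, zpow_natCast, mul_comm, pow_mul,
          hw, one_pow, one_zpow, Units.val_one]
      -- The same branch of the root is therefore evaluated at the same value on both sides.
      have hlast : lastPow N s ((diag ![omega N, u] ^ k) x) = lastPow N s x := by
        rw [diag_pair_zpow_apply, lastPow, lastPow]
        simp only [Matrix.cons_val_zero, Matrix.cons_val_one, mul_pow, hpow hω, hpow hu, one_mul]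
      have hvec : diag t • chartVec s x (ρ (lastPow N s x)) = chartVec s
          ((diag ![omega N, u] ^ k) x) (ρ (lastPow N s ((diag ![omega N, u] ^ k) x))) := by
        ext a
        obtain ⟨b, rfl⟩ := s.surjective a
        change (t (s b) : ℂ) * chartVec s x _ (s b) = _
        rw [hlast, chartVec_apply, chartVec_apply, diag_pair_zpow_apply]
        fin_cases b
        · simp [ht0]
        · simp [ht1]
        · simp [htr _ s20 s21]
        · simp [htr _ s30 s31]
      simp only [hvec]
  refine ⟨quotientChart (holAt_smul_H hN) e he _ Metric.isOpen_ball (isConnected_ball 0 hr) hball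
    _ (finite_zpowers_diag hN hω hu) hinv hfib, ⟨e, he, hball, fun x _ => rfl⟩, rfl,
    Metric.mem_ball_self hr, congrArg (toWH N) hep⟩

theorem exists_trivial_chart {N : ℕ} (hN : N ≠ 0) (p : Fermat N) {i : Fin 4}
    (hi : ∀ r, r ≠ i → p.1.rep r ≠ 0) :
    ∃ c : OrbifoldChart 2 (WH N), IsLiftedChart N c ∧ c.group = ⊥ ∧
      ∃ x ∈ c.dom, c.toFun x = toWH N p := by
  have := continuousConstSMul_H hN
  have perm : ∀ i : Fin 4, ∃ s : Equiv.Perm (Fin 4), s 0 = i := by decide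
  obtain ⟨s, rfl⟩ := perm i
  have h2 := hi (s 2) (s.injective.ne (by decide))
  have h3 := hi (s 3) (s.injective.ne (by decide))
  obtain ⟨e, ρ, r, he, hr, hball, hep, hform, hstab⟩ := exists_adapted_localParam hN s p h2 h3
  have hfib : ∀ x ∈ Metric.ball (affineCoords s p.1) r, ∀ y ∈ Metric.ball (affineCoords s p.1) r,
      (∃ h : H N, h • e x = e y) ↔ ∃ k ∈ (⊥ : Subgroup (GLin 2)), k x = y := by
    intro x hx y hy
    constructor
    · rintro ⟨h, hxy⟩
      have hp := hstab x hx y hy h hxy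
      obtain ⟨t, ht⟩ := exists_torusAut_eq hN h
      rw [ht] at hp hxy
      have hp' := congrArg Subtype.val hp
      have hxy' := congrArg Subtype.val hxy
      rw [torusAut_apply] at hp' hxy'
      rw [hform x (hball hx), hform y (hball hy)] at hxy'
      have hy' := smul_coord_of_diag_smul_chartVec hxy'
      have h12 := eq_of_diag_smul_eq hp' (s 1) (s 2) (hi (s 1) (s.injective.ne (by decide))) h2
      have h32 := eq_of_diag_smul_eq hp' (s 3) (s 2) h3 h2
      -- Three entries agree at the nonzero coordinates; the relation `t 0 * t 1 = t 2 * t 3` gives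
      -- the fourth by cancellation.
      have h02 : t.1 (s 0) = t.1 (s 2) := by
        have all : ∀ r, r ≠ s 0 → t.1 r = t.1 (s 2) := by
          intro a ha
          obtain ⟨b, rfl⟩ := s.surjective a
          fin_cases b
          exacts [absurd rfl ha, h12, rfl, h32]
        have hrel := t.2.2
        generalize s 0 = a at all ⊢
        generalize t.1 (s 2) = τ at all ⊢
        fin_cases a
        · rw [all 1 (by decide), all 2 (by decide), all 3 (by decide)] at hrel
          exact mul_right_cancel hrel
        · rw [all 0 (by decide), all 2 (by decide), all 3 (by decide)] at hrel
          exact mul_left_cancel hrel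
        · rw [all 0 (by decide), all 1 (by decide), all 3 (by decide)] at hrel
          exact (mul_right_cancel hrel).symm
        · rw [all 0 (by decide), all 1 (by decide), all 2 (by decide)] at hrel
          exact (mul_left_cancel hrel).symm
      refine ⟨1, Subgroup.mem_bot.2 rfl, ?_⟩
      rw [hy', h02, h12]
      ext k
      fin_cases k <;> simp
    · rintro ⟨k, hk, rfl⟩
      rw [Subgroup.mem_bot.1 hk]
      exact ⟨1, one_smul _ _⟩
  refine ⟨quotientChart (holAt_smul_H hN) e he _ Metric.isOpen_ball (isConnected_ball _ hr) hball
    ⊥ inferInstance (fun g hg x hx => by rw [Subgroup.mem_bot.1 hg]; exact hx) hfib,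
    ⟨e, he, hball, fun x _ => rfl⟩, rfl, _, Metric.mem_ball_self hr, congrArg (toWH N) hep⟩

/-- The indices lie on opposite sides of `t 0 * t 1 = t 2 * t 3`. With both other entries equal to
`τ`, cancelling `τ` leaves `t i = t j`. -/
theorem exists_scalar_chart {N : ℕ} (hN : N ≠ 0) (p : Fermat N) {i j : Fin 4}
    (hij : IsScalarPair i j) (hi : p.1.rep i = 0) (hj : p.1.rep j = 0) :
    ∃ c : OrbifoldChart 2 (WH N), IsLiftedChart N c ∧ c.group = scalarGroup N ∧ 0 ∈ c.dom ∧
      c.toFun 0 = toWH N p := by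
  have hω := omega_pow_eq_one hN
  have hne : i ≠ j := by
    rcases hij with ⟨rfl, rfl⟩ | ⟨rfl, rfl⟩ | ⟨rfl, rfl⟩ | ⟨rfl, rfl⟩ <;> decide
  refine exists_cyclic_chart hN p hne hi hj hω (fun k => ?_) fun t ht τ hτ => ?_
  · have hk : (omega N ^ k) ^ N = 1 := by
      rw [← zpow_natCast, zpow_comm, zpow_natCast, hω, one_zpow]
    refine ⟨fun r => if r = i ∨ r = j then omega N ^ k else 1, ⟨fun r => ?_, ?_⟩, by simp, by simp,
      fun r hri hrj => by simp [hri, hrj]⟩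
    · dsimp only
      split_ifs
      exacts [hk, one_pow N]
    · rcases hij with ⟨rfl, rfl⟩ | ⟨rfl, rfl⟩ | ⟨rfl, rfl⟩ | ⟨rfl, rfl⟩ <;> simp
  · have htij : t i = t j := by
      have hrel := ht.2
      rcases hij with ⟨rfl, rfl⟩ | ⟨rfl, rfl⟩ | ⟨rfl, rfl⟩ | ⟨rfl, rfl⟩
      · rw [hτ 1 (by decide) (by decide), hτ 3 (by decide) (by decide)] at hrel
        exact mul_right_cancel hrel
      · rw [hτ 1 (by decide) (by decide), hτ 2 (by decide) (by decide), mul_comm τ] at hrel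
        exact mul_right_cancel hrel
      · rw [hτ 0 (by decide) (by decide), hτ 3 (by decide) (by decide), mul_comm τ] at hrel
        exact mul_right_cancel hrel
      · rw [hτ 0 (by decide) (by decide), hτ 2 (by decide) (by decide)] at hrel
        exact mul_left_cancel hrel
    have third : ∀ i j : Fin 4, ∃ r, r ≠ i ∧ r ≠ j := by decide
    obtain ⟨r, hri, hrj⟩ := third i j
    have hτN : τ ^ N = 1 := by rw [← hτ r hri hrj]; exact ht.1 r
    obtain ⟨k, hk⟩ := exists_omega_pow_eq hN (u := t i / τ) (by
      rw [div_pow, ht.1, hτN, div_one])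
    refine ⟨k, ?_, ?_⟩
    · rw [zpow_natCast, hk]
    · rw [zpow_natCast, hk, htij]

/-- The indices lie on the same side of `t 0 * t 1 = t 2 * t 3`, so `t i * t j = τ * τ` and the
ratios to `τ` are mutually inverse. -/
theorem exists_typeA_chart {N : ℕ} (hN : N ≠ 0) (p : Fermat N) {i j : Fin 4}
    (hij : IsTypeAPair i j) (hi : p.1.rep i = 0) (hj : p.1.rep j = 0) :
    ∃ c : OrbifoldChart 2 (WH N), IsLiftedChart N c ∧ c.group = typeAGroup N ∧ 0 ∈ c.dom ∧
      c.toFun 0 = toWH N p := by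
  have hω := omega_pow_eq_one hN
  have hne : i ≠ j := by
    rcases hij with ⟨rfl, rfl⟩ | ⟨rfl, rfl⟩ <;> decide
  refine exists_cyclic_chart hN p hne hi hj (by rw [inv_pow, hω, inv_one]) (fun k => ?_)
    fun t ht τ hτ => ?_
  · have hk : (omega N ^ k) ^ N = 1 := by
      rw [← zpow_natCast, zpow_comm, zpow_natCast, hω, one_zpow]
    refine ⟨fun r => if r = i then omega N ^ k else if r = j then (omega N ^ k)⁻¹ else 1,
      ⟨fun r => ?_, ?_⟩, by simp, by simp [hne.symm], fun r hri hrj => by simp [hri, hrj]⟩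
    · dsimp only
      split_ifs
      exacts [hk, by rw [inv_pow, hk, inv_one], one_pow N]
    · rcases hij with ⟨rfl, rfl⟩ | ⟨rfl, rfl⟩ <;> simp
  · have htij : t i * t j = τ * τ := by
      have hrel := ht.2
      rcases hij with ⟨rfl, rfl⟩ | ⟨rfl, rfl⟩
      · rwa [hτ 2 (by decide) (by decide), hτ 3 (by decide) (by decide)] at hrel
      · rw [hτ 0 (by decide) (by decide), hτ 1 (by decide) (by decide)] at hrel
        exact hrel.symm
    have third : ∀ i j : Fin 4, ∃ r, r ≠ i ∧ r ≠ j := by decide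
    obtain ⟨r, hri, hrj⟩ := third i j
    have hτN : τ ^ N = 1 := by rw [← hτ r hri hrj]; exact ht.1 r
    obtain ⟨k, hk⟩ := exists_omega_pow_eq hN (u := t i / τ) (by
      rw [div_pow, ht.1, hτN, div_one])
    refine ⟨k, ?_, ?_⟩
    · rw [zpow_natCast, hk]
    · rw [zpow_natCast, inv_pow, hk, inv_div, div_eq_div_iff_mul_eq_mul, mul_comm, htij]

/-! ### The orbifold structure -/

/-- The images of the points where the coordinates of one of the pairs `P` vanish. -/
def pairImage (N : ℕ) (P : Fin 4 → Fin 4 → Prop) : Set (WH N) :=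
  {q | ∃ p : Fermat N, (∃ i j, P i j ∧ p.1.rep i = 0 ∧ p.1.rep j = 0) ∧ toWH N p = q}

theorem singImage_eq {N : ℕ} (hN : 2 ≤ N) :
    singImage N = pairImage N IsScalarPair ∪ pairImage N IsTypeAPair := by
  ext q
  constructor
  · rintro ⟨κ, hκ | hκ, p, hp, rfl⟩
    · exact Or.inl ⟨p, exists_scalarPair hN hκ hp, rfl⟩
    · exact Or.inr ⟨p, exists_typeAPair hN hκ hp, rfl⟩
  · rintro (⟨p, ⟨i, j, hij, hi, hj⟩, rfl⟩ | ⟨p, ⟨i, j, hij, hi, hj⟩, rfl⟩)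
    · obtain ⟨κ, hκ, hp⟩ := exists_zeroOrInfty hN hij hi hj
      exact ⟨κ, Or.inl hκ, p, hp, rfl⟩
    · obtain ⟨κ, hκ, hp⟩ := exists_plusMinusOne hN hij hi hj
      exact ⟨κ, Or.inr hκ, p, hp, rfl⟩

/-- The charts of the orbifold structure of the quotient surface. -/
def chartSet (N : ℕ) : Set (OrbifoldChart 2 (WH N)) :=
  {c | IsLiftedChart N c ∧ (c.group = ⊥ ∨
    (c.group = scalarGroup N ∧ c.toFun 0 ∈ pairImage N IsScalarPair) ∨
    (c.group = typeAGroup N ∧ c.toFun 0 ∈ pairImage N IsTypeAPair))}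

theorem exists_scalar_mem_chartSet {N : ℕ} (hN : 2 ≤ N) {q : WH N}
    (hq : q ∈ pairImage N IsScalarPair) :
    ∃ c ∈ chartSet N, c.group = scalarGroup N ∧ 0 ∈ c.dom ∧ c.toFun 0 = q := by
  obtain ⟨p, ⟨i, j, hij, hi, hj⟩, rfl⟩ := id hq
  obtain ⟨c, hc, hG, h0, hc0⟩ := exists_scalar_chart (by lia) p hij hi hj
  exact ⟨c, ⟨hc, Or.inr (Or.inl ⟨hG, by rwa [hc0]⟩)⟩, hG, h0, hc0⟩

theorem exists_typeA_mem_chartSet {N : ℕ} (hN : 2 ≤ N) {q : WH N}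
    (hq : q ∈ pairImage N IsTypeAPair) :
    ∃ c ∈ chartSet N, c.group = typeAGroup N ∧ 0 ∈ c.dom ∧ c.toFun 0 = q := by
  obtain ⟨p, ⟨i, j, hij, hi, hj⟩, rfl⟩ := id hq
  obtain ⟨c, hc, hG, h0, hc0⟩ := exists_typeA_chart (by lia) p hij hi hj
  exact ⟨c, ⟨hc, Or.inr (Or.inr ⟨hG, by rwa [hc0]⟩)⟩, hG, h0, hc0⟩

theorem exists_trivial_mem_chartSet {N : ℕ} (hN : 2 ≤ N) {q : WH N} (hq : q ∉ singImage N) :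
    ∃ c ∈ chartSet N, c.group = ⊥ ∧ ∃ x ∈ c.dom, c.toFun x = q := by
  obtain ⟨p, rfl⟩ : ∃ p, toWH N p = q := Quotient.exists_rep q
  rw [singImage_eq hN, Set.mem_union, not_or] at hq
  have hpair : ∀ i j, i ≠ j → p.1.rep i = 0 → p.1.rep j ≠ 0 := by
    -- The scalar and type `A` pairs exhaust the six pairs of coordinates, so off `singImage` at
    -- most one coordinate vanishes.
    have cases : ∀ i j : Fin 4, i ≠ j →
        (IsScalarPair i j ∨ IsTypeAPair i j) ∨ (IsScalarPair j i ∨ IsTypeAPair j i) := by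
      unfold IsScalarPair IsTypeAPair
      decide
    intro i j hij hi hj
    rcases cases i j hij with (h | h) | (h | h)
    · exact hq.1 ⟨p, ⟨i, j, h, hi, hj⟩, rfl⟩
    · exact hq.2 ⟨p, ⟨i, j, h, hi, hj⟩, rfl⟩
    · exact hq.1 ⟨p, ⟨j, i, h, hj, hi⟩, rfl⟩
    · exact hq.2 ⟨p, ⟨j, i, h, hj, hi⟩, rfl⟩
  obtain ⟨i, hi⟩ : ∃ i, ∀ r, r ≠ i → p.1.rep r ≠ 0 := by
    by_cases h : ∃ i, p.1.rep i = 0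
    · obtain ⟨i, hi⟩ := h
      exact ⟨i, fun r hr => hpair i r hr.symm hi⟩
    · exact ⟨0, fun r _ hr => h ⟨r, hr⟩⟩
  obtain ⟨c, hc, hG, x, hx, hcx⟩ := exists_trivial_chart (by lia) p hi
  exact ⟨c, ⟨hc, Or.inl hG⟩, hG, x, hx, hcx⟩

theorem IsLiftedChart.exists_transition {N : ℕ} (hN : N ≠ 0) {c c' : OrbifoldChart 2 (WH N)}
    (hc : IsLiftedChart N c) (hc' : IsLiftedChart N c') {x y : Fin 2 → ℂ} (hx : x ∈ c.dom)
    (hy : y ∈ c'.dom) (hxy : c.toFun x = c'.toFun y) :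
    ∃ h : OpenPartialHomeomorph (Fin 2 → ℂ) (Fin 2 → ℂ),
      x ∈ h.source ∧ h x = y ∧ h.source ⊆ c.dom ∧ h.target ⊆ c'.dom ∧
      AnalyticOnNhd ℂ h h.source ∧ AnalyticOnNhd ℂ h.symm h.target ∧
      ∀ z ∈ h.source, c'.toFun (h z) = c.toFun z := by
  have := continuousConstSMul_H hN
  obtain ⟨e, he, hce, hcf⟩ := hc
  obtain ⟨e', he', hce', hcf'⟩ := hc'
  rw [hcf x hx, hcf' y hy] at hxy
  obtain ⟨g, hg⟩ : ∃ g : H N, g • e x = e' y :=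
    MulAction.mem_orbit_symm.1 (MulAction.orbitRel_apply.1 (Quotient.exact hxy))
  obtain ⟨h, h₁, h₂, h₃, h₄, h₅, h₆, h₇⟩ := he.exists_transition (holAt_smul_H hN) he'
    c.isOpen_dom c'.isOpen_dom hce hce' hx hy hg
  refine ⟨h, h₁, h₂, h₃, h₄, h₅, h₆, fun z hz => ?_⟩
  rw [hcf z (h₃ hz), hcf' _ (h₄ (h.map_source hz)), ← h₇ z hz]
  exact Quotient.sound (MulAction.orbitRel_apply.2 ⟨g, rfl⟩)

/-- The orbifold structure of the quotient surface. -/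
def quotientAtlas {N : ℕ} (hN : 2 ≤ N) : OrbifoldAtlas 2 (WH N) where
  t2Space := by
    have hN0 : N ≠ 0 := by lia
    have := finite_H hN0
    have := continuousConstSMul_H hN0
    exact t2Space_orbitRel_quotient
  secondCountable := by
    have := continuousConstSMul_H (N := N) (by lia)
    exact TopologicalSpace.Quotient.secondCountableTopology
      (isOpenMap_quotient_mk'_mul (Γ := H N) (T := Fermat N))
  charts := chartSet N
  cover q := by
    by_cases hq : q ∈ singImage N
    · rw [singImage_eq hN] at hq
      rcases hq with hq | hq
      · obtain ⟨c, hc, -, h0, hcq⟩ := exists_scalar_mem_chartSet hN hq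
        exact ⟨c, hc, 0, h0, hcq⟩
      · obtain ⟨c, hc, -, h0, hcq⟩ := exists_typeA_mem_chartSet hN hq
        exact ⟨c, hc, 0, h0, hcq⟩
    · obtain ⟨c, hc, -, x, hx, hcq⟩ := exists_trivial_mem_chartSet hN hq
      exact ⟨c, hc, x, hx, hcq⟩
  compatible c hc c' hc' x hx y hy hxy :=
    hc.1.exists_transition (by lia) hc'.1 hx hy hxy

/-- By `h` a nontrivial power has neither diagonal entry equal to `1`, so the action is free away
from the origin. -/
theorem eq_zero_of_fixed {w u : ℂˣ} (h : ∀ k : ℤ, w ^ k = 1 ↔ u ^ k = 1) {g : GLin 2}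
    (hg : g ∈ Subgroup.zpowers (diag ![w, u])) (hg1 : g ≠ 1) {x : Fin 2 → ℂ} (hx : g x = x) :
    x = 0 := by
  obtain ⟨k, rfl⟩ := hg
  have hk : w ^ k ≠ 1 := by
    intro hk
    refine hg1 (LinearEquiv.ext fun y => ?_)
    change (diag ![w, u] ^ k) y = y
    rw [diag_pair_zpow_apply, hk, (h k).1 hk]
    ext i
    fin_cases i <;> simp
  have hk' : u ^ k ≠ 1 := fun hu => hk ((h k).2 hu)
  change (diag ![w, u] ^ k) x = x at hx
  rw [diag_pair_zpow_apply] at hx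
  have fix : ∀ {v : ℂˣ} {z : ℂ}, v ≠ 1 → (v : ℂ) * z = z → z = 0 := by
    intro v z hv hz
    by_contra hz0
    exact hv (Units.ext (mul_right_cancel₀ hz0 (by rw [hz, Units.val_one, one_mul])))
  ext i
  fin_cases i
  · exact fix hk (by simpa using congrFun hx 0)
  · exact fix hk' (by simpa using congrFun hx 1)

theorem diag_pair_ne_one {N : ℕ} (hN : 2 ≤ N) (u : ℂˣ) : diag ![omega N, u] ≠ 1 := by
  intro h
  have := congrArg (fun g : GLin 2 => g ![1, 0] 0) h
  have hω : (omega N : ℂ) = 1 := by simpa using this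
  exact (isPrimitiveRoot_omega (N := N) (by lia)).ne_one (by lia) hω

/-- In each chart only the origin can have isotropy, and `chartSet` admits a chart with nontrivial
group only if its centre is the image of a point with a vanishing pair. -/
theorem singularLocus_quotientAtlas {N : ℕ} (hN : 2 ≤ N) :
    (quotientAtlas hN).singularLocus = singImage N := by
  rw [singImage_eq hN]
  ext q
  constructor
  · rintro ⟨c, hc, x, hx, rfl, g, hg, hg1, hgx⟩
    rcases hc.2 with hG | ⟨hG, hq⟩ | ⟨hG, hq⟩
    · rw [hG] at hg
      exact absurd (Subgroup.mem_bot.1 hg) hg1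
    · rw [hG] at hg
      rw [eq_zero_of_fixed (fun k => Iff.rfl) hg hg1 hgx]
      exact Or.inl hq
    · rw [hG] at hg
      rw [eq_zero_of_fixed (fun k => by rw [inv_zpow, inv_eq_one]) hg hg1 hgx]
      exact Or.inr hq
  · rintro (hq | hq)
    · obtain ⟨c, hc, hG, h0, hcq⟩ := exists_scalar_mem_chartSet hN hq
      exact ⟨c, hc, 0, h0, hcq, _, by rw [hG]; exact Subgroup.mem_zpowers _,
        diag_pair_ne_one hN _, map_zero _⟩
    · obtain ⟨c, hc, hG, h0, hcq⟩ := exists_typeA_mem_chartSet hN hq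
      exact ⟨c, hc, 0, h0, hcq, _, by rw [hG]; exact Subgroup.mem_zpowers _,
        diag_pair_ne_one hN _, map_zero _⟩

/-- The first direction is the local model claimed in the theorem; the second carries nonsingularity
of `q` over to the plane quotient, where it is refuted. -/
theorem germIso_planeOrigin {X : Type*} [TopologicalSpace X] [HolSpace X] {c : OrbifoldChart 2 X}
    {G : Subgroup (GLin 2)} (hG : c.group = G) (h0 : 0 ∈ c.dom) {q : X} (hq : c.toFun 0 = q) :
    GermIso q (planeOrigin G) ∧ GermIso (planeOrigin G) q := by
  subst hG hq
  exact ⟨c.germIso h0, c.germIso_symm h0⟩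

theorem setOf_not_isNonsingularAt {N : ℕ} (hN : 2 ≤ N) :
    {q : WH N | ¬ IsNonsingularAt 2 q} = singImage N := by
  ext q
  constructor
  · intro hq
    by_contra hs
    obtain ⟨c, -, hG, x, hx, rfl⟩ := exists_trivial_mem_chartSet hN hs
    exact hq (c.isNonsingularAt hG hx)
  · intro hq h
    rw [singImage_eq hN] at hq
    rcases hq with hq | hq
    · obtain ⟨c, -, hG, h0, hcq⟩ := exists_scalar_mem_chartSet hN hq
      exact not_isNonsingularAt_scalar hN ((germIso_planeOrigin hG h0 hcq).2.trans h)
    · obtain ⟨c, -, hG, h0, hcq⟩ := exists_typeA_mem_chartSet hN hq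
      exact not_isNonsingularAt_typeA hN ((germIso_planeOrigin hG h0 hcq).2.trans h)

end RapidityFamily

end

theorem mainTheorem6 (N : ℕ) (hN : 2 ≤ N) :
    ∃ A : RapidityFamily.OrbifoldAtlas 2 (RapidityFamily.WH N),
      A.singularLocus = RapidityFamily.singImage N ∧
      {q : RapidityFamily.WH N | ¬ RapidityFamily.IsNonsingularAt 2 q} =
        RapidityFamily.singImage N ∧
      (∀ κ : RapidityFamily.Param, κ.ZeroOrInfty → ∀ p ∈ RapidityFamily.fibreSing N κ,
        A.LocallyQuotient (RapidityFamily.toWH N p) (RapidityFamily.scalarGroup N) ∧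
        RapidityFamily.GermIso (RapidityFamily.toWH N p)
          (RapidityFamily.planeOrigin (RapidityFamily.scalarGroup N))) ∧
      (∀ κ : RapidityFamily.Param, κ.PlusMinusOne → ∀ p ∈ RapidityFamily.fibreSing N κ,
        A.LocallyQuotient (RapidityFamily.toWH N p) (RapidityFamily.typeAGroup N) ∧
        RapidityFamily.GermIso (RapidityFamily.toWH N p)
          (RapidityFamily.planeOrigin (RapidityFamily.typeAGroup N))) := by
  refine ⟨RapidityFamily.quotientAtlas hN, RapidityFamily.singularLocus_quotientAtlas hN,
    RapidityFamily.setOf_not_isNonsingularAt hN, fun κ hκ p hp => ?_, fun κ hκ p hp => ?_⟩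
  · obtain ⟨c, hc, hG, h0, hcq⟩ := RapidityFamily.exists_scalar_mem_chartSet hN
      ⟨p, RapidityFamily.exists_scalarPair hN hκ hp, rfl⟩
    exact ⟨⟨c, hc, hG, h0, hcq⟩, (RapidityFamily.germIso_planeOrigin hG h0 hcq).1⟩
  · obtain ⟨c, hc, hG, h0, hcq⟩ := RapidityFamily.exists_typeA_mem_chartSet hN
      ⟨p, RapidityFamily.exists_typeAPair hN hκ hp, rfl⟩
    exact ⟨⟨c, hc, hG, h0, hcq⟩, (RapidityFamily.germIso_planeOrigin hG h0 hcq).1⟩
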